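/- Let $(\Omega,\mathcal F,(\mathcal F_n)_{n\in\mathbb N},\mu)$ be a filtered probability space, let $f=(f_n)_{n\in\mathbb N}$ be a complex-valued adapted process and $g=(g_n)_{n\in\mathbb N}$ a complex-valued martingale. Write $\delta f_{s,t}=f_t-f_s$, $dg_j=g_j-g_{j-1}$, $Sg=\bigl(\sum_{j\ge1}|dg_j|^2\bigr)^{1/2}$ and, for $s\le t$, $$\Pi(\delta f,g)_{s,t}=\sum_{s<j\le t}(f_{j-1}-f_s)\,dg_j .$$ For $0<r<\infty$ and a function $P=(P_{s,t})_{s\le t}$ of two time variables let $V^rP=\sup_{J,\,u_0<\dots<u_J}\bigl(\sum_{j=1}^J|P_{u_{j-1},u_j}|^r\bigr)^{1/r}$, the supremum being over all finite increasing sequences in $\mathbb N$, let $V^\infty P=\sup_{s<t}|P_{s,t}|$, and let $V^rf=V^r(\delta f)$. An adapted partition is a sequence $0=\tau_0\le\tau_1\le\cdots$ of stopping times with values in $\mathbb N\cup\{\infty\}$. We write $\ell^r_k a_k=(\sum_{k\ge1}|a_k|^r)^{1/r}$ (supremum if $r=\infty$), $\|\cdot\|_q$ for the $L^q(\mu)$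 (quasi-)norm, and set suprema of nonnegative quantities over empty sets to be $0$; time variables $s,t$ range over $\mathbb N$. Norms may be infinite, with $0\cdot\infty=0$. Let $$0<q,q_1\le\infty,\quad 1\le q_0<\infty,\quad 1\le r_1\le\infty,\quad \tfrac1q=\tfrac1{q_0}+\tfrac1{q_1}.$$ (a) If $1\le r<\infty$ and $\tfrac1r=\tfrac12+\tfrac1{r_1}$, then there is a constant $C<\infty$ depending only on $q_0,q_1,r,r_1$ such that, for all such filtered probability spaces, $f$, $g$ and all adapted partitions $\tau$, $$\Bigl\|\ell^r_k\sup_{\tau_{k-1}\le s\le t\le\tau_k}|\Pi(\delta f,g)_{s,t}|\Bigr\|_q\le C\,\Bigl\|\ell^{r_1}_k\sup_{\tau_{k-1}\le t<\tau_k}|\delta f_{\tau_{k-1},t}|\Bigr\|_{q_1}\|Sg\|_{q_0}.$$ (b) If $0<r\le\infty$ and $\tfrac1r<\tfrac12+\tfrac1{r_1}$, then there is a constant $C<\infty$ depending only on $q_0,q_1,r,r_1$ such that, for all such filtered probability spaces, $f$ and $g$, $$\|V^r\Pi(\delta f,g)\|_q\le C\,\|V^{r_1}f\|_{q_1}\|Sg\|_{q_0}.$$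 -/

import Mathlib

open MeasureTheory
open scoped ENNReal NNReal

namespace MartingaleParaproduct

/-- The increment process `δf_{s,t} = f_t - f_s` of a sequence `f`. -/
def delta (f : ℕ → ℂ) (s t : ℕ) : ℂ := f t - f s

/-- The discrete paraproduct `Π(F,g)_{s,t} = ∑_{s < j ≤ t} F_{s,j-1} (g_j - g_{j-1})`. -/
def paraproduct (F : ℕ → ℕ → ℂ) (g : ℕ → ℂ) (s t : ℕ) : ℂ :=
  ∑ j ∈ Finset.Ioc s t, F s (j - 1) * (g j - g (j - 1))

/-- The `ℓ^r` (quasi-)norm, `0 < r ≤ ∞`, of a sequence with values in `[0, ∞]`. -/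
noncomputable def ellNorm (r : ℝ≥0∞) (a : ℕ → ℝ≥0∞) : ℝ≥0∞ :=
  if r = ∞ then ⨆ k, a k else (∑' k, a k ^ r.toReal) ^ (1 / r.toReal)

/-- The `r`-variation, `0 < r ≤ ∞`, on the whole time axis `ℕ` of a function `P` of two time
variables: the supremum, over all finite sequences `u_0 < ⋯ < u_J`, of
`(∑_{j=1}^J |P_{u_{j-1},u_j}|^r)^{1/r}`, and, if `r = ∞`, the supremum of `|P_{s,t}|`
over `s < t`. -/
noncomputable def rVar₂ (r : ℝ≥0∞) (P : ℕ → ℕ → ℂ) : ℝ≥0∞ :=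
  if r = ∞ then ⨆ (s : ℕ) (t : ℕ) (_ : s < t), ‖P s t‖ₑ
  else ⨆ (J : ℕ) (u : Fin (J + 1) → ℕ) (_ : StrictMono u),
    (∑ j : Fin J, ‖P (u j.castSucc) (u j.succ)‖ₑ ^ r.toReal) ^ (1 / r.toReal)

/-- The `r`-variation `V^r f` of a sequence. -/
noncomputable def rVar (r : ℝ≥0∞) (f : ℕ → ℂ) : ℝ≥0∞ := rVar₂ r (delta f)

/-- The square function `(∑_{j ≥ 1} |g_j - g_{j-1}|²)^{1/2}`. -/
noncomputable def squareFn (g : ℕ → ℂ) : ℝ≥0∞ :=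
  (∑' j : ℕ, ‖g (j + 1) - g j‖ₑ ^ (2 : ℝ)) ^ (1 / 2 : ℝ)

/-- An adapted partition: a nondecreasing sequence `0 = τ_0 ≤ τ_1 ≤ ⋯` of stopping times with
values in `ℕ ∪ {∞}`. It is not required that `τ_k → ∞`. -/
structure IsAdaptedPartition {Ω : Type*} {m : MeasurableSpace Ω} (ℱ : Filtration ℕ m)
    (τ : ℕ → Ω → WithTop ℕ) : Prop where
  isStoppingTime : ∀ k, IsStoppingTime ℱ (τ k)
  zero : ∀ ω, τ 0 ω = 0
  mono : ∀ ω, Monotone fun k => τ k ω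

end MartingaleParaproduct

open MartingaleParaproduct

/-!
The estimates rest on an `ℓ²`-valued Burkholder–Davis–Gundy inequality at exponents `p ≥ 1`,
`exists_lintegral_tsum_sq_maximal_le`, and on two pathwise reductions to it.

*The Burkholder–Davis–Gundy inequality.* For a finite family of martingales `x i` starting at `0`,
with running maxima `m i`, the squared energy `∑ i, (m i ^ 2 + (m i - 2 * ‖x i‖) ^ 2) + Q ^ 2`, where
`Q` is the square function, is comparable to `∑ i, m i ^ 2 + Q ^ 2`. In one step it grows by at most
a martingale increment plus `5 ‖dx‖²` (`sq_energy_succ_le`). As the energy dominates `Q`, its `p`-th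
power grows by at most a martingale increment plus a multiple of `energy ^ (p - 1)` times the
increment of `Q` (`exists_rpow_step`). Summation and Young's inequality give the pathwise inequality
`exists_pathwise_bdg`, in which no assumption on the size of the jumps is needed, also for `p = 1`;
taking expectations removes the martingale transform.

*The maximal estimate.* On the interval from `τ_k` to `τ_{k+1}`, let `A` be the running maximum of
`‖f - f_{τ_k}‖`. The quotient `(f - f_{τ_k}) / A` is predictable and bounded by `1`, so that its
integral against `g` obeys the Burkholder–Davis–Gundy inequality with the square function of `g`.
Summation by parts, `A` being nondecreasing, bounds the paraproduct on that interval by the largest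
deviation of `f` times maximal functions of two martingale transforms of `g`
(`paraproductMax_le`). Hölder's inequality, first in `k` and then in `ω`, concludes. This allows all
exponents `q > 0`, as the Burkholder–Davis–Gundy inequality is only applied at the exponent `q₀`.

*The variation norm estimate.* Let `1 / ρ = 1 / 2 + 1 / r₁`, so that `ρ < r`. Terms of a variation
sum at which the running maximum of the paraproduct doubles contribute a geometric sum. Any other
nonzero term is, for some `m`, comparable to `2^{-m}` times the running maximum, and is charged to an
interval of the adapted partition which stops whenever the paraproduct since the last stopping time
exceeds `2^{-m-1}` times its running maximum. This bounds the `r`-variation by the `ℓ^ρ` norms over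
these partitions with weights decaying geometrically in `m` (`sum_rpow_le_threshold`). The maximal
estimate at the exponent `ρ` holds for each of the partitions with the same constant, because the
deviations of `f` are bounded by its `r₁`-variation (`ellNorm_deviation_le_rVar`).
-/

namespace MartingaleParaproduct

/-! ### Inequalities for real powers -/

/-- Used at `x = a / b` to compare the weights `a ^ (p - 2)` and `b ^ (p - 2)`, where `s = p - 1`. -/
lemma exists_abs_rpow_sub_self_le (s : ℝ) (hs : 0 ≤ s) :
    ∃ C : ℝ, 0 ≤ C ∧ ∀ x : ℝ, 0 ≤ x → x ≤ 2 → |x ^ s - x| ≤ C * |1 - x| := by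
  set n := ⌈s⌉₊
  have hsn : s ≤ n := Nat.le_ceil s
  refine ⟨n * 2 ^ n + 1, by positivity, fun x hx0 hx2 => ?_⟩
  have h1 : |x ^ n - 1| ≤ n * 2 ^ n * |1 - x| := by
    rw [← mul_geom_sum, abs_mul, abs_sub_comm, mul_comm]
    gcongr
    rw [abs_of_nonneg (Finset.sum_nonneg fun i _ => by positivity)]
    calc ∑ i ∈ Finset.range n, x ^ i ≤ ∑ i ∈ Finset.range n, (2 : ℝ) ^ n := by
          refine Finset.sum_le_sum fun i hi => ?_
          calc x ^ i ≤ 2 ^ i := by gcongr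
            _ ≤ 2 ^ n := pow_le_pow_right₀ (by norm_num) (Finset.mem_range.1 hi).le
      _ = n * 2 ^ n := by simp
  have h2 : |x ^ s - 1| ≤ |x ^ n - 1| := by
    rcases le_total 1 x with h | h
    · have a1 : 1 ≤ x ^ s := Real.one_le_rpow h hs
      have a2 : x ^ s ≤ x ^ n := by
        rw [← Real.rpow_natCast]; exact Real.rpow_le_rpow_of_exponent_le h hsn
      rw [abs_of_nonneg (by linarith), abs_of_nonneg (by linarith)]; linarith
    · have a1 : x ^ s ≤ 1 := Real.rpow_le_one hx0 h hs
      have a2 : x ^ n ≤ x ^ s := by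
        rcases hx0.eq_or_lt with rfl | hx
        · rcases hs.eq_or_lt with rfl | hs
          · simp [n]
          · rw [zero_pow (by simpa [n] using hs), Real.zero_rpow hs.ne']
        · rw [← Real.rpow_natCast]; exact Real.rpow_le_rpow_of_exponent_ge hx h hsn
      rw [abs_of_nonpos (by linarith), abs_of_nonpos (by linarith)]; linarith
  calc |x ^ s - x| = |(x ^ s - 1) + (1 - x)| := by ring_nf
    _ ≤ |x ^ s - 1| + |1 - x| := abs_add_le _ _
    _ ≤ _ := by nlinarith

/-- The one-step inequality behind the pathwise Burkholder–Davis–Gundy inequality, `a` and `b` being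
the energies before and after the step, and `Q` and `Q'` the square functions: a second order
expansion of `a ↦ a ^ p`, in which the quadratic term `δ² = Q'² - Q²` is absorbed into
`b ^ (p - 1) * (Q' - Q)` because `b` dominates `Q'`. -/
lemma exists_rpow_step (p : ℝ) (hp : 1 ≤ p) :
    ∃ C : ℝ, 0 ≤ C ∧ ∀ a b Q Q' δ y : ℝ, 0 ≤ a → 0 ≤ b → 0 ≤ Q → 0 ≤ δ → 0 ≤ Q' →
      Q' ^ 2 = Q ^ 2 + δ ^ 2 → Q' ≤ b → a ≤ 2 * b → |b - a| ≤ 3 * δ → |y| ≤ 4 * a * δ →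
      b ^ 2 ≤ a ^ 2 + y + 5 * δ ^ 2 →
      b ^ p ≤ a ^ p + p / 2 * (a ^ (p - 2) * y) + C * (b ^ (p - 1) * (Q' - Q)) := by
  obtain ⟨C, hC0, hC⟩ := exists_abs_rpow_sub_self_le (p - 1) (by linarith)
  refine ⟨p * (14 + 12 * C), by positivity, ?_⟩
  intro a b Q Q' δ y ha hb hQ hδ hQ' hQQ hQb hab hba hy hbb
  rcases hb.eq_or_lt with rfl | hb
  · have : a = 0 := by linarith
    subst this
    have : Q' = 0 := by linarith
    subst this
    have : Q = 0 := by nlinarith [sq_nonneg δ]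
    subst this
    have : y = 0 := by simpa using hy
    subst this
    simp
  have hQle : Q ≤ Q' := by nlinarith [sq_nonneg δ]
  have hbp : 0 < b ^ (p - 2) := Real.rpow_pos_of_pos hb _
  have e1 : b ^ (p - 1) = b ^ (p - 2) * b := by
    rw [← Real.rpow_add_one hb.ne']; ring_nf
  have e2 : b ^ p = b ^ (p - 2) * b ^ 2 := by
    rw [← Real.rpow_natCast b 2, ← Real.rpow_add hb]; norm_num
  -- the tangent line inequality at `b`
  have htan : b ^ p + p * (b ^ (p - 1) * (a - b)) ≤ a ^ p := by
    have h := one_add_mul_self_le_rpow_one_add (s := a / b - 1)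
      (by have : 0 ≤ a / b := by positivity
          linarith) hp
    rw [add_sub_cancel, Real.div_rpow ha hb.le, le_div_iff₀ (by positivity)] at h
    calc _ = (1 + p * (a / b - 1)) * b ^ p := by
          rw [e1, e2]; field_simp
      _ ≤ _ := h
  have hsq : (b - a) ^ 2 ≤ 9 * δ ^ 2 := by
    have := sq_le_sq' (abs_le.1 hba).1 (abs_le.1 hba).2
    nlinarith
  have h2 : 2 * (b * (b - a)) ≤ y + 14 * δ ^ 2 := by nlinarith
  -- replacing the weight `b ^ (p - 2)` by `a ^ (p - 2)`
  have hw : |b ^ (p - 2) - a ^ (p - 2)| * a ≤ C * b ^ (p - 2) * |b - a| := by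
    rcases ha.eq_or_lt with rfl | ha
    · simp; positivity
    have hx := hC (a / b) (by positivity) (by rw [div_le_iff₀ hb]; linarith)
    have ea : a ^ (p - 1) = a ^ (p - 2) * a := by
      rw [← Real.rpow_add_one ha.ne']; ring_nf
    have k1 : |b ^ (p - 2) - a ^ (p - 2)| * a
        = b ^ (p - 1) * |(a / b) ^ (p - 1) - a / b| := by
      rw [Real.div_rpow ha.le hb.le, ← abs_of_pos ha, ← abs_mul, abs_of_pos ha]
      rw [← abs_of_pos (show 0 < b ^ (p - 1) by positivity), ← abs_mul,
        abs_of_pos (show 0 < b ^ (p - 1) by positivity), ← abs_neg]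
      congr 1
      rw [ea, e1]
      field_simp
      ring
    have k2 : b ^ (p - 2) * |b - a| = b ^ (p - 1) * |1 - a / b| := by
      rw [e1, mul_assoc, ← abs_of_pos hb, ← abs_mul, abs_of_pos hb]
      congr 2
      field_simp
    rw [k1, mul_assoc, k2]
    calc _ ≤ b ^ (p - 1) * (C * |1 - a / b|) := by gcongr
      _ = _ := by ring
  have h3 : (b ^ (p - 2) - a ^ (p - 2)) * y ≤ 12 * C * b ^ (p - 2) * δ ^ 2 := by
    calc _ ≤ |(b ^ (p - 2) - a ^ (p - 2)) * y| := le_abs_self _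
      _ = |b ^ (p - 2) - a ^ (p - 2)| * |y| := abs_mul _ _
      _ ≤ |b ^ (p - 2) - a ^ (p - 2)| * (4 * a * δ) := by gcongr
      _ = |b ^ (p - 2) - a ^ (p - 2)| * a * (4 * δ) := by ring
      _ ≤ C * b ^ (p - 2) * |b - a| * (4 * δ) := by gcongr
      _ ≤ C * b ^ (p - 2) * (3 * δ) * (4 * δ) := by gcongr
      _ = _ := by ring
  have h4 : b ^ (p - 2) * δ ^ 2 ≤ 2 * (b ^ (p - 1) * (Q' - Q)) := by
    rw [e1]
    have : δ ^ 2 ≤ 2 * (b * (Q' - Q)) := by nlinarith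
    calc _ ≤ b ^ (p - 2) * (2 * (b * (Q' - Q))) := by gcongr
      _ = _ := by ring
  have h5 : b ^ (p - 2) * (2 * (b * (b - a))) ≤ b ^ (p - 2) * (y + 14 * δ ^ 2) := by gcongr
  have h6 : b ^ (p - 2) * y = a ^ (p - 2) * y + (b ^ (p - 2) - a ^ (p - 2)) * y := by ring
  have h7 : p * (b ^ (p - 1) * (b - a))
      ≤ p * (1 / 2 * (a ^ (p - 2) * y) + (14 + 12 * C) * (b ^ (p - 1) * (Q' - Q))) := by
    gcongr
    have : (14 + 12 * C) / 2 * (b ^ (p - 2) * δ ^ 2)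
        ≤ (14 + 12 * C) / 2 * (2 * (b ^ (p - 1) * (Q' - Q))) := by gcongr
    have e3 : b ^ (p - 1) * (b - a) = b ^ (p - 2) * (2 * (b * (b - a))) / 2 := by rw [e1]; ring
    rw [e3]
    nlinarith
  nlinarith

/-- Young's inequality in the form needed to absorb a power of `a`. -/
lemma exists_mul_rpow_le_half_add (p K : ℝ) (hp : 1 ≤ p) (hK : 0 < K) :
    ∃ C : ℝ, 0 ≤ C ∧ ∀ a Q : ℝ, 0 ≤ a → 0 ≤ Q →
      K * (a ^ (p - 1) * Q) ≤ 1 / 2 * a ^ p + C * Q ^ p := by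
  refine ⟨K * (2 * K) ^ (p - 1), by positivity, fun a Q ha hQ => ?_⟩
  have key : ∀ z : ℝ, 0 ≤ z → z ^ p = z ^ (p - 1) * z := fun z hz => by
    have h := Real.rpow_add_of_nonneg hz (y := p - 1) (z := 1) (by linarith) (by norm_num)
    rw [Real.rpow_one] at h
    rw [← h]; ring_nf
  rcases le_total (2 * K * Q) a with h | h
  · have : K * (a ^ (p - 1) * Q) ≤ 1 / 2 * a ^ p := by
      rw [key a ha]
      have : a ^ (p - 1) * (2 * K * Q) ≤ a ^ (p - 1) * a := by gcongr
      linarith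
    have h2 : 0 ≤ K * (2 * K) ^ (p - 1) * Q ^ p := by positivity
    linarith
  · have h1 : K * (a ^ (p - 1) * Q) ≤ K * ((2 * K * Q) ^ (p - 1) * Q) := by
      have : a ^ (p - 1) ≤ (2 * K * Q) ^ (p - 1) :=
        Real.rpow_le_rpow ha h (by linarith)
      gcongr
    have h2 : 0 ≤ 1 / 2 * a ^ p := by positivity
    rw [Real.mul_rpow (by positivity) hQ] at h1
    rw [key Q hQ]
    nlinarith

/-! ### The pathwise Burkholder–Davis–Gundy inequality -/

section Pathwise

variable {ι : Type*} [Fintype ι]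

/-- The running maximum `max_{s ≤ t} ‖x s‖`. -/
noncomputable def runMax (x : ℕ → ℂ) (t : ℕ) : ℝ := partialSups (fun s => ‖x s‖) t

lemma runMax_succ (x : ℕ → ℂ) (t : ℕ) : runMax x (t + 1) = max (runMax x t) ‖x (t + 1)‖ :=
  partialSups_succ _ t

lemma norm_le_runMax (x : ℕ → ℂ) {s t : ℕ} (h : s ≤ t) : ‖x s‖ ≤ runMax x t :=
  le_partialSups_of_le (fun s => ‖x s‖) h

lemma runMax_nonneg (x : ℕ → ℂ) (t : ℕ) : 0 ≤ runMax x t :=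
  (norm_nonneg _).trans (norm_le_runMax x le_rfl)

lemma runMax_mono (x : ℕ → ℂ) : Monotone (runMax x) := (partialSups fun s => ‖x s‖).monotone

/-- The squared Euclidean norm of the increment `x (t + 1) - x t`, for a vector valued sequence. -/
noncomputable def sqIncr (x : ι → ℕ → ℂ) (t : ℕ) : ℝ := ∑ i, ‖x i (t + 1) - x i t‖ ^ 2

/-- The square function of a vector valued sequence, up to time `t`. -/
noncomputable def sqFun (x : ι → ℕ → ℂ) (t : ℕ) : ℝ := √(∑ j ∈ Finset.range t, sqIncr x j)

/-- An energy comparable to `(∑ i, max_{s ≤ t} ‖x i s‖²)^{1/2} + sqFun x t`. The summand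
`m² + (m - 2 ‖x‖)²` lies between `m²` and `2 m²`, `m` being the running maximum, and its increment is
at most a martingale increment plus `4 ‖dx‖²`. -/
noncomputable def energy (x : ι → ℕ → ℂ) (t : ℕ) : ℝ :=
  √(∑ i, (runMax (x i) t ^ 2 + (runMax (x i) t - 2 * ‖x i t‖) ^ 2)
    + ∑ j ∈ Finset.range t, sqIncr x j)

/-- The factor of the first order term of the energy. The quotient is `0` where `x t = 0`. -/
noncomputable def energyFactor (x : ℕ → ℂ) (t : ℕ) : ℝ := 8 - 4 * (runMax x t / ‖x t‖)

/-- The first order term of the increment of the squared energy. -/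
noncomputable def energyIncr (x : ι → ℕ → ℂ) (t : ℕ) : ℝ :=
  ∑ i, energyFactor (x i) t * inner ℝ (x i t) (x i (t + 1) - x i t)

lemma sqIncr_nonneg (x : ι → ℕ → ℂ) (t : ℕ) : 0 ≤ sqIncr x t :=
  Finset.sum_nonneg fun _ _ => by positivity

lemma sum_sqIncr_nonneg (x : ι → ℕ → ℂ) (t : ℕ) : 0 ≤ ∑ j ∈ Finset.range t, sqIncr x j :=
  Finset.sum_nonneg fun _ _ => sqIncr_nonneg x _

lemma energy_nonneg (x : ι → ℕ → ℂ) (t : ℕ) : 0 ≤ energy x t := Real.sqrt_nonneg _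

lemma sqFun_nonneg (x : ι → ℕ → ℂ) (t : ℕ) : 0 ≤ sqFun x t := Real.sqrt_nonneg _

lemma sq_sqFun (x : ι → ℕ → ℂ) (t : ℕ) : sqFun x t ^ 2 = ∑ j ∈ Finset.range t, sqIncr x j :=
  Real.sq_sqrt (sum_sqIncr_nonneg x t)

lemma sq_energy (x : ι → ℕ → ℂ) (t : ℕ) :
    energy x t ^ 2 = ∑ i, (runMax (x i) t ^ 2 + (runMax (x i) t - 2 * ‖x i t‖) ^ 2)
      + sqFun x t ^ 2 := by
  rw [sq_sqFun]
  exact Real.sq_sqrt (add_nonneg (Finset.sum_nonneg fun _ _ => by positivity)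
    (sum_sqIncr_nonneg x t))

lemma sq_sqFun_succ (x : ι → ℕ → ℂ) (t : ℕ) :
    sqFun x (t + 1) ^ 2 = sqFun x t ^ 2 + sqIncr x t := by
  rw [sq_sqFun, sq_sqFun, Finset.sum_range_succ]

lemma sqFun_mono (x : ι → ℕ → ℂ) : Monotone (sqFun x) :=
  monotone_nat_of_le_succ fun t => by
    have := sq_sqFun_succ x t
    have := sqIncr_nonneg x t
    exact (sq_le_sq₀ (sqFun_nonneg _ _) (sqFun_nonneg _ _)).1 (by linarith)

lemma sqFun_le_energy (x : ι → ℕ → ℂ) (t : ℕ) : sqFun x t ≤ energy x t := by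
  refine (sq_le_sq₀ (sqFun_nonneg _ _) (energy_nonneg _ _)).1 ?_
  rw [sq_energy]
  have : 0 ≤ ∑ i, (runMax (x i) t ^ 2 + (runMax (x i) t - 2 * ‖x i t‖) ^ 2) :=
    Finset.sum_nonneg fun _ _ => by positivity
  linarith

lemma sum_sq_runMax_le_sq_energy (x : ι → ℕ → ℂ) (t : ℕ) :
    ∑ i, runMax (x i) t ^ 2 ≤ energy x t ^ 2 := by
  rw [sq_energy]
  have : ∑ i, runMax (x i) t ^ 2
      ≤ ∑ i, (runMax (x i) t ^ 2 + (runMax (x i) t - 2 * ‖x i t‖) ^ 2) :=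
    Finset.sum_le_sum fun i _ => by nlinarith [sq_nonneg (runMax (x i) t - 2 * ‖x i t‖)]
  nlinarith [sq_nonneg (sqFun x t)]

lemma energy_le_two_mul (x : ι → ℕ → ℂ) {s t : ℕ} (h : s ≤ t) : energy x s ≤ 2 * energy x t := by
  refine (sq_le_sq₀ (energy_nonneg _ _) (by linarith [energy_nonneg x t])).1 ?_
  rw [mul_pow, sq_energy, sq_energy]
  have h1 : sqFun x s ^ 2 ≤ sqFun x t ^ 2 :=
    pow_le_pow_left₀ (sqFun_nonneg _ _) (sqFun_mono x h) 2
  have h2 : ∑ i, (runMax (x i) s ^ 2 + (runMax (x i) s - 2 * ‖x i s‖) ^ 2)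
      ≤ ∑ i, 2 * (runMax (x i) t ^ 2 + (runMax (x i) t - 2 * ‖x i t‖) ^ 2) := by
    refine Finset.sum_le_sum fun i _ => ?_
    have a1 := runMax_mono (x i) h
    have a2 := norm_le_runMax (x i) (le_refl s)
    have a3 := norm_nonneg (x i s)
    have a4 := pow_le_pow_left₀ (runMax_nonneg (x i) s) a1 2
    nlinarith [sq_nonneg (runMax (x i) t - 2 * ‖x i t‖)]
  rw [← Finset.mul_sum] at h2
  have h3 : 0 ≤ ∑ i, (runMax (x i) t ^ 2 + (runMax (x i) t - 2 * ‖x i t‖) ^ 2) :=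
    Finset.sum_nonneg fun _ _ => by positivity
  nlinarith [sq_nonneg (sqFun x t)]

lemma abs_energyFactor_mul_norm_le (x : ℕ → ℂ) (t : ℕ) :
    |energyFactor x t| * ‖x t‖ ≤ 4 * runMax x t := by
  have h1 := norm_le_runMax x (le_refl t)
  rcases (norm_nonneg (x t)).eq_or_lt with h | h
  · rw [← h]; simpa using runMax_nonneg x t
  · have : |energyFactor x t| * ‖x t‖ = |8 * ‖x t‖ - 4 * runMax x t| := by
      rw [← abs_of_pos h, ← abs_mul, abs_of_pos h, energyFactor]
      congr 1
      field_simp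
    rw [this, abs_le]
    constructor <;> linarith

lemma abs_energyIncr_le (x : ι → ℕ → ℂ) (t : ℕ) :
    |energyIncr x t| ≤ 4 * energy x t * √(sqIncr x t) := by
  calc |energyIncr x t| ≤ ∑ i, |energyFactor (x i) t * inner ℝ (x i t) (x i (t + 1) - x i t)| :=
        Finset.abs_sum_le_sum_abs _ _
    _ ≤ ∑ i, 4 * (runMax (x i) t * ‖x i (t + 1) - x i t‖) := by
        refine Finset.sum_le_sum fun i _ => ?_
        rw [abs_mul]
        calc _ ≤ |energyFactor (x i) t| * (‖x i t‖ * ‖x i (t + 1) - x i t‖) := by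
              gcongr; exact abs_real_inner_le_norm _ _
          _ = (|energyFactor (x i) t| * ‖x i t‖) * ‖x i (t + 1) - x i t‖ := by ring
          _ ≤ (4 * runMax (x i) t) * ‖x i (t + 1) - x i t‖ := by
              exact mul_le_mul_of_nonneg_right (abs_energyFactor_mul_norm_le _ _) (norm_nonneg _)
          _ = _ := by ring
    _ = 4 * ∑ i, runMax (x i) t * ‖x i (t + 1) - x i t‖ := by rw [Finset.mul_sum]
    _ ≤ 4 * (√(∑ i, runMax (x i) t ^ 2) * √(sqIncr x t)) := by
        gcongr; exact Real.sum_mul_le_sqrt_mul_sqrt _ _ _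
    _ ≤ 4 * (energy x t * √(sqIncr x t)) := by
        gcongr
        rw [Real.sqrt_le_left (energy_nonneg _ _)]
        exact sum_sq_runMax_le_sq_energy x t
    _ = _ := by ring

lemma sq_energy_succ_le (x : ι → ℕ → ℂ) (t : ℕ) :
    energy x (t + 1) ^ 2 ≤ energy x t ^ 2 + energyIncr x t + 5 * sqIncr x t := by
  rw [sq_energy, sq_energy, sq_sqFun_succ]
  suffices h : ∑ i, (runMax (x i) (t + 1) ^ 2 + (runMax (x i) (t + 1) - 2 * ‖x i (t + 1)‖) ^ 2)
      ≤ ∑ i, (runMax (x i) t ^ 2 + (runMax (x i) t - 2 * ‖x i t‖) ^ 2)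
        + energyIncr x t + 4 * sqIncr x t by linarith
  rw [energyIncr, sqIncr, Finset.mul_sum, ← Finset.sum_add_distrib, ← Finset.sum_add_distrib]
  refine Finset.sum_le_sum fun i _ => ?_
  rw [runMax_succ, energyFactor]
  have hm := norm_le_runMax (x i) (le_refl t)
  set m := runMax (x i) t
  set u := x i t
  set v := x i (t + 1)
  have hn := norm_nonneg u
  have hn' := norm_nonneg v
  have e1 : ‖v‖ ^ 2 = ‖u‖ ^ 2 + 2 * inner ℝ u (v - u) + ‖v - u‖ ^ 2 := by
    have := norm_add_sq_real u (v - u)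
    rwa [add_sub_cancel] at this
  have e2 : ‖u‖ ^ 2 + inner ℝ u (v - u) ≤ ‖u‖ * ‖v‖ := by
    have := real_inner_le_norm u v
    rwa [← add_sub_cancel u v, inner_add_right, real_inner_self_eq_norm_sq,
      add_sub_cancel] at this
  set R := inner ℝ u (v - u) with hR
  -- when the maximum increases, its old value may be kept in the bound
  have key : max m ‖v‖ ^ 2 + (max m ‖v‖ - 2 * ‖v‖) ^ 2 ≤ m ^ 2 + (m - 2 * ‖v‖) ^ 2 := by
    rcases le_total ‖v‖ m with h | h
    · rw [max_eq_left h]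
    · rw [max_eq_right h]; nlinarith [sq_nonneg (‖v‖ - m)]
  have key2 : ‖u‖ + R / ‖u‖ ≤ ‖v‖ := by
    rcases hn.eq_or_lt with h | h
    · rw [← h]; simp
    · have : ‖u‖ + R / ‖u‖ = (‖u‖ ^ 2 + R) / ‖u‖ := by field_simp
      rw [this, div_le_iff₀ h]; linarith
  have e3 : (8 - 4 * (m / ‖u‖)) * R = 8 * R - 4 * (m * (R / ‖u‖)) := by ring
  rw [e3]
  have hm0 : 0 ≤ m := hn.trans hm
  have : m * (‖u‖ + R / ‖u‖) ≤ m * ‖v‖ := by gcongr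
  nlinarith

lemma abs_energy_succ_sub_le (x : ι → ℕ → ℂ) (t : ℕ) :
    |energy x (t + 1) - energy x t| ≤ 3 * √(sqIncr x t) := by
  set δ := √(sqIncr x t) with hδ
  have hδ2 : sqIncr x t = δ ^ 2 := (Real.sq_sqrt (sqIncr_nonneg x t)).symm
  have hδ0 : 0 ≤ δ := Real.sqrt_nonneg _
  have ha := energy_nonneg x t
  have hb := energy_nonneg x (t + 1)
  rw [abs_le]
  constructor
  · suffices h : energy x t ^ 2 ≤ (energy x (t + 1) + 3 * δ) ^ 2 by
      have := (sq_le_sq₀ ha (by positivity)).1 h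
      linarith
    have h1 : ∑ i, (runMax (x i) t ^ 2 + (runMax (x i) t - 2 * ‖x i t‖) ^ 2)
        ≤ ∑ i, (runMax (x i) (t + 1) ^ 2 + (runMax (x i) (t + 1) - 2 * ‖x i (t + 1)‖) ^ 2)
          + 6 * ∑ i, |runMax (x i) (t + 1) - 2 * ‖x i (t + 1)‖| * ‖x i (t + 1) - x i t‖
          + 9 * sqIncr x t := by
      rw [sqIncr, Finset.mul_sum, Finset.mul_sum, ← Finset.sum_add_distrib,
        ← Finset.sum_add_distrib]
      refine Finset.sum_le_sum fun i _ => ?_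
      have hm := runMax_mono (x i) (Nat.le_succ t)
      have hm1 := norm_le_runMax (x i) (le_refl t)
      have hm' : runMax (x i) (t + 1) ≤ runMax (x i) t + ‖x i (t + 1) - x i t‖ := by
        rw [runMax_succ]
        refine max_le (by linarith [norm_nonneg (x i (t + 1) - x i t)]) ?_
        have := norm_le_norm_add_norm_sub' (x i (t + 1)) (x i t)
        linarith
      have hv := abs_norm_sub_norm_le (x i (t + 1)) (x i t)
      set d := ‖x i (t + 1) - x i t‖
      have hd : 0 ≤ d := norm_nonneg _
      have hw : |runMax (x i) t - 2 * ‖x i t‖|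
          ≤ |runMax (x i) (t + 1) - 2 * ‖x i (t + 1)‖| + 3 * d := by
        have h0 : |(runMax (x i) t - 2 * ‖x i t‖)
            - (runMax (x i) (t + 1) - 2 * ‖x i (t + 1)‖)| ≤ 3 * d := by
          have := abs_le.1 hv
          change runMax (x i) t ≤ runMax (x i) (t + 1) at hm
          rw [abs_le]
          constructor <;> linarith
        have := abs_sub_abs_le_abs_sub (runMax (x i) t - 2 * ‖x i t‖)
          (runMax (x i) (t + 1) - 2 * ‖x i (t + 1)‖)
        linarith
      have hw2 := pow_le_pow_left₀ (abs_nonneg _) hw 2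
      rw [sq_abs] at hw2
      have hm2 := pow_le_pow_left₀ (runMax_nonneg (x i) t) hm 2
      have := sq_abs (runMax (x i) (t + 1) - 2 * ‖x i (t + 1)‖)
      change runMax (x i) t ^ 2 ≤ runMax (x i) (t + 1) ^ 2 at hm2
      nlinarith
    have h2 : ∑ i, |runMax (x i) (t + 1) - 2 * ‖x i (t + 1)‖| * ‖x i (t + 1) - x i t‖
        ≤ energy x (t + 1) * δ := by
      refine (Real.sum_mul_le_sqrt_mul_sqrt _ _ _).trans ?_
      refine mul_le_mul_of_nonneg_right ?_ hδ0
      rw [Real.sqrt_le_left hb, sq_energy]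
      have : ∑ i, |runMax (x i) (t + 1) - 2 * ‖x i (t + 1)‖| ^ 2
          ≤ ∑ i, (runMax (x i) (t + 1) ^ 2
            + (runMax (x i) (t + 1) - 2 * ‖x i (t + 1)‖) ^ 2) :=
        Finset.sum_le_sum fun i _ => by
          rw [sq_abs]; nlinarith [sq_nonneg (runMax (x i) (t + 1))]
      nlinarith [sq_nonneg (sqFun x (t + 1))]
    have h3 := sq_energy x t
    have h4 := sq_energy x (t + 1)
    have h5 := sq_sqFun_succ x t
    nlinarith
  · suffices h : energy x (t + 1) ^ 2 ≤ (energy x t + 3 * δ) ^ 2 by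
      have := (sq_le_sq₀ hb (by positivity)).1 h
      linarith
    have h1 := sq_energy_succ_le x t
    have h2 := (abs_le.1 (abs_energyIncr_le x t)).2
    rw [hδ2] at h1
    rw [← hδ] at h2
    nlinarith [mul_nonneg ha hδ0]

lemma energy_zero (x : ι → ℕ → ℂ) (h0 : ∀ i, x i 0 = 0) : energy x 0 = 0 := by
  simp [energy, runMax, h0]

lemma sqFun_zero (x : ι → ℕ → ℂ) : sqFun x 0 = 0 := by simp [sqFun]

/-- The pathwise Burkholder–Davis–Gundy inequality: the sum on the right-hand side is a martingale
transform when `x` is a martingale. -/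
theorem exists_pathwise_bdg (p : ℝ) (hp : 1 ≤ p) :
    ∃ C : ℝ, 0 < C ∧ ∀ {ι : Type} [Fintype ι] (x : ι → ℕ → ℂ) (_ : ∀ i, x i 0 = 0) (T : ℕ),
      energy x T ^ p ≤ p * ∑ j ∈ Finset.range T, energy x j ^ (p - 2) * energyIncr x j
        + C * sqFun x T ^ p := by
  obtain ⟨C₁, hC₁, h1⟩ := exists_rpow_step p hp
  obtain ⟨C₂, hC₂, h2⟩ := exists_mul_rpow_le_half_add p (C₁ * 2 ^ (p - 1) + 1) hp (by positivity)
  refine ⟨2 * C₂ + 1, by positivity, fun x h0 T => ?_⟩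
  have hstep : ∀ t < T, energy x (t + 1) ^ p ≤ energy x t ^ p
      + p / 2 * (energy x t ^ (p - 2) * energyIncr x t)
      + (C₁ * 2 ^ (p - 1) + 1) * (energy x T ^ (p - 1) * (sqFun x (t + 1) - sqFun x t)) := by
    intro t ht
    have hQ := sqFun_mono x (Nat.le_succ t)
    have h := h1 (energy x t) (energy x (t + 1)) (sqFun x t) (sqFun x (t + 1)) (√(sqIncr x t))
      (energyIncr x t) (energy_nonneg _ _) (energy_nonneg _ _) (sqFun_nonneg _ _)
      (Real.sqrt_nonneg _) (sqFun_nonneg _ _)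
      (by rw [Real.sq_sqrt (sqIncr_nonneg _ _), sq_sqFun_succ]) (sqFun_le_energy _ _)
      (energy_le_two_mul x (Nat.le_succ t)) (abs_energy_succ_sub_le x t)
      (abs_energyIncr_le x t)
      (by rw [Real.sq_sqrt (sqIncr_nonneg _ _)]; exact sq_energy_succ_le x t)
    refine h.trans ?_
    refine add_le_add le_rfl ?_
    have h3 : energy x (t + 1) ^ (p - 1) ≤ 2 ^ (p - 1) * energy x T ^ (p - 1) := by
      rw [← Real.mul_rpow (by norm_num) (energy_nonneg _ _)]
      exact Real.rpow_le_rpow (energy_nonneg _ _) (energy_le_two_mul x ht) (by linarith)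
    have h4 : 0 ≤ sqFun x (t + 1) - sqFun x t := sub_nonneg.2 hQ
    have h5 : 0 ≤ energy x T ^ (p - 1) := Real.rpow_nonneg (energy_nonneg _ _) _
    calc C₁ * (energy x (t + 1) ^ (p - 1) * (sqFun x (t + 1) - sqFun x t))
        ≤ C₁ * (2 ^ (p - 1) * energy x T ^ (p - 1) * (sqFun x (t + 1) - sqFun x t)) := by gcongr
      _ = C₁ * 2 ^ (p - 1) * (energy x T ^ (p - 1) * (sqFun x (t + 1) - sqFun x t)) := by ring
      _ ≤ _ := by
        have := mul_nonneg h5 h4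
        gcongr
        linarith
  have hsum : ∀ t ≤ T, energy x t ^ p
      ≤ p / 2 * ∑ j ∈ Finset.range t, energy x j ^ (p - 2) * energyIncr x j
        + (C₁ * 2 ^ (p - 1) + 1) * (energy x T ^ (p - 1) * sqFun x t) := by
    intro t
    induction t with
    | zero =>
      intro _
      simp [energy_zero x h0, sqFun_zero, Real.zero_rpow (by linarith : p ≠ 0)]
    | succ t ih =>
      intro ht
      have := ih (Nat.le_of_succ_le ht)
      have := hstep t ht
      rw [Finset.sum_range_succ]
      nlinarith
  have h3 := hsum T le_rfl
  have h4 := h2 (energy x T) (sqFun x T) (energy_nonneg _ _) (sqFun_nonneg _ _)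
  have h5 : 0 ≤ sqFun x T ^ p := Real.rpow_nonneg (sqFun_nonneg _ _) _
  nlinarith

/-- A crude bound, used only for integrability. -/
lemma energy_le_mul_sqFun (x : ι → ℕ → ℂ) (h0 : ∀ i, x i 0 = 0) {t T : ℕ} (h : t ≤ T) :
    energy x t ≤ 3 * t * sqFun x T := by
  induction t with
  | zero => simp [energy_zero x h0]
  | succ t ih =>
    have h1 := ih (Nat.le_of_succ_le h)
    have h2 := (abs_le.1 (abs_energy_succ_sub_le x t)).2
    have h3 : √(sqIncr x t) ≤ sqFun x T := by
      refine Real.sqrt_le_sqrt ?_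
      exact Finset.single_le_sum (f := sqIncr x) (fun j _ => sqIncr_nonneg x j)
        (Finset.mem_range.2 h)
    push_cast
    nlinarith

lemma sqrt_sqIncr_le_sqFun (x : ι → ℕ → ℂ) {t T : ℕ} (h : t < T) :
    √(sqIncr x t) ≤ sqFun x T :=
  Real.sqrt_le_sqrt (Finset.single_le_sum (f := sqIncr x) (fun j _ => sqIncr_nonneg x j)
    (Finset.mem_range.2 h))

end Pathwise

/-! ### Measurability of the energy -/

section Measurability

variable {Ω : Type*} {m : MeasurableSpace Ω} {ι : Type*} [Fintype ι]

lemma measurable_runMax {x : ℕ → Ω → ℂ} {t : ℕ} (hx : ∀ s ≤ t, Measurable (x s)) :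
    Measurable fun ω => runMax (fun s => x s ω) t := by
  induction t with
  | zero => simpa [runMax] using (hx 0 le_rfl).norm
  | succ t ih =>
    simp only [runMax_succ]
    exact (ih fun s hs => hx s (hs.trans (Nat.le_succ t))).max (hx _ le_rfl).norm

lemma measurable_sqIncr {x : ι → ℕ → Ω → ℂ} {t : ℕ} (hx : ∀ i, ∀ s ≤ t + 1, Measurable (x i s)) :
    Measurable fun ω => sqIncr (fun i s => x i s ω) t :=
  Finset.measurable_sum _ fun i _ =>
    ((hx i _ le_rfl).sub (hx i _ (Nat.le_succ t))).norm.pow_const 2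

lemma measurable_sum_sqIncr {x : ι → ℕ → Ω → ℂ} {t : ℕ} (hx : ∀ i, ∀ s ≤ t, Measurable (x i s)) :
    Measurable fun ω => ∑ j ∈ Finset.range t, sqIncr (fun i s => x i s ω) j :=
  Finset.measurable_sum _ fun _ hj => measurable_sqIncr fun i s hs =>
    hx i s (hs.trans (Finset.mem_range.1 hj))

lemma measurable_sqFun {x : ι → ℕ → Ω → ℂ} {t : ℕ} (hx : ∀ i, ∀ s ≤ t, Measurable (x i s)) :
    Measurable fun ω => sqFun (fun i s => x i s ω) t :=
  (measurable_sum_sqIncr hx).sqrt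

lemma measurable_energy {x : ι → ℕ → Ω → ℂ} {t : ℕ} (hx : ∀ i, ∀ s ≤ t, Measurable (x i s)) :
    Measurable fun ω => energy (fun i s => x i s ω) t := by
  refine Measurable.sqrt (Measurable.add (Finset.measurable_sum _ fun i _ => ?_)
    (measurable_sum_sqIncr hx))
  have h1 := measurable_runMax (hx i)
  exact (h1.pow_const 2).add ((h1.sub ((hx i t le_rfl).norm.const_mul 2)).pow_const 2)

lemma measurable_energyFactor {x : ℕ → Ω → ℂ} {t : ℕ} (hx : ∀ s ≤ t, Measurable (x s)) :
    Measurable fun ω => energyFactor (fun s => x s ω) t :=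
  (((measurable_runMax hx).div (hx t le_rfl).norm).const_mul 4).const_sub 8

end Measurability

/-! ### The vector valued Burkholder–Davis–Gundy inequality -/

section Martingale

variable {Ω : Type*} {m : MeasurableSpace Ω} {μ : Measure Ω} {ℱ : Filtration ℕ m}

/-- The increment of a martingale, multiplied by a factor known in advance, has conditional
expectation zero. -/
lemma condExp_bilin_increment_eq_zero {F G : Type*} [NormedAddCommGroup F] [NormedSpace ℝ F]
    [NormedAddCommGroup G] [NormedSpace ℝ G] [CompleteSpace G] [IsFiniteMeasure μ]
    {g : ℕ → Ω → ℂ} (hg : Martingale g ℱ μ) (B : F →L[ℝ] ℂ →L[ℝ] G) (j : ℕ) {θ : Ω → F}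
    (hθ : StronglyMeasurable[ℱ j] θ)
    (hint : Integrable (fun ω => B (θ ω) (g (j + 1) ω - g j ω)) μ) :
    μ[fun ω => B (θ ω) (g (j + 1) ω - g j ω) | ℱ j] =ᵐ[μ] 0 := by
  have h1 := condExp_bilin_of_stronglyMeasurable_left B hθ hint
    ((hg.integrable (j + 1)).sub (hg.integrable j))
  have h2 := condExp_sub (hg.integrable (j + 1)) (hg.integrable j) (ℱ j)
  have h3 := hg.2 j (j + 1) (Nat.le_succ j)
  have h4 := hg.2 j j le_rfl
  filter_upwards [h1, h2, h3, h4] with ω a1 a2 a3 a4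
  rw [a1]
  change B (θ ω) ((μ[g (j + 1) - g j | ℱ j]) ω) = 0
  rw [a2, Pi.sub_apply, a3, a4, sub_self, map_zero]

/-- The martingale transform `∑_{j < t} H_j (g_{j+1} - g_j)`; the factor of the increment over
`[j, j + 1]` carries the index `j`, so that predictability means that `H` is adapted. -/
noncomputable def transform (H : ℕ → Ω → ℂ) (g : ℕ → Ω → ℂ) (t : ℕ) (ω : Ω) : ℂ :=
  ∑ j ∈ Finset.range t, H j ω * (g (j + 1) ω - g j ω)

lemma transform_succ_sub (H g : ℕ → Ω → ℂ) (t : ℕ) (ω : Ω) :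
    transform H g (t + 1) ω - transform H g t ω = H t ω * (g (t + 1) ω - g t ω) := by
  simp [transform, Finset.sum_range_succ]

lemma martingale_transform [IsFiniteMeasure μ] {H g : ℕ → Ω → ℂ} (hg : Martingale g ℱ μ)
    (hH : ∀ j, Measurable[ℱ j] (H j)) (hb : ∀ j ω, ‖H j ω‖ ≤ 1) :
    Martingale (transform H g) ℱ μ := by
  have hHs : ∀ j, StronglyMeasurable[ℱ j] (H j) := fun j => (hH j).stronglyMeasurable
  have hint : ∀ j, Integrable (fun ω => H j ω * (g (j + 1) ω - g j ω)) μ := fun j =>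
    ((hg.integrable (j + 1)).sub (hg.integrable j)).bdd_mul
      ((hHs j).mono (ℱ.le j)).aestronglyMeasurable (c := 1) (.of_forall fun ω => hb j ω)
  have hadp : StronglyAdapted ℱ (transform H g) := fun t => by
    refine Finset.stronglyMeasurable_fun_sum _ fun j hj => ?_
    have hj := Finset.mem_range.1 hj
    exact ((hHs j).mono (ℱ.mono hj.le)).mul
      (((hg.1 (j + 1)).mono (ℱ.mono hj)).sub ((hg.1 j).mono (ℱ.mono hj.le)))
  have hti : ∀ t, Integrable (transform H g t) μ := fun t =>
    integrable_finsetSum _ fun j _ => hint j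
  refine martingale_nat hadp hti fun t => ?_
  have e : transform H g (t + 1)
      = transform H g t + fun ω => H t ω * (g (t + 1) ω - g t ω) := by
    ext ω
    simp [transform, Finset.sum_range_succ]
  have h1 := condExp_bilin_increment_eq_zero hg (ContinuousLinearMap.mul ℝ ℂ) t (hHs t) (hint t)
  have h2 := condExp_add (hti t) (hint t) (ℱ t)
  have h3 := condExp_of_stronglyMeasurable (ℱ.le t) (hadp t) (hti t)
  rw [e]
  filter_upwards [h1, h2] with ω a1 a2
  rw [a2, Pi.add_apply, h3]
  simp only [ContinuousLinearMap.mul_apply'] at a1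
  rw [a1]
  simp

/-- The `ℓ²`-valued Burkholder–Davis–Gundy inequality for finitely many martingales up to a finite
time. -/
theorem exists_lintegral_energy_le (p : ℝ) (hp : 1 ≤ p) :
    ∃ C : ℝ≥0, 0 < C ∧ ∀ {ι : Type} [Fintype ι] {Ω : Type*} {m : MeasurableSpace Ω}
      {μ : Measure Ω} [IsFiniteMeasure μ] {ℱ : Filtration ℕ m} (N : ι → ℕ → Ω → ℂ)
      (_ : ∀ i, Martingale (N i) ℱ μ) (_ : ∀ i ω, N i 0 ω = 0) (T : ℕ),
      ∫⁻ ω, ENNReal.ofReal (energy (fun i t => N i t ω) T ^ p) ∂μ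
        ≤ C * ∫⁻ ω, ENNReal.ofReal (sqFun (fun i t => N i t ω) T ^ p) ∂μ := by
  obtain ⟨C, hC, h⟩ := exists_pathwise_bdg p hp
  refine ⟨C.toNNReal, Real.toNNReal_pos.2 hC, fun {ι} _ {Ω m μ} _ {ℱ} N hN h0 T => ?_⟩
  set x : Ω → ι → ℕ → ℂ := fun ω i t => N i t ω
  have hx0 : ∀ ω i, x ω i 0 = 0 := fun ω i => h0 i ω
  have hmeas : ∀ j i, ∀ s ≤ j, Measurable[ℱ j] (N i s) := fun j i s hs =>
    (((hN i).1 s).mono (ℱ.mono hs)).measurable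
  have hmeas' : ∀ i s, Measurable (N i s) := fun i s => (((hN i).1 s).mono (ℱ.le s)).measurable
  have hQm : Measurable fun ω => sqFun (x ω) T := measurable_sqFun fun i s _ => hmeas' i s
  by_cases hfin : ∫⁻ ω, ENNReal.ofReal (sqFun (x ω) T ^ p) ∂μ = ∞
  · rw [hfin, ENNReal.mul_top]
    · exact le_top
    · exact_mod_cast (Real.toNNReal_pos.2 hC).ne'
  have hQ : Integrable (fun ω => sqFun (x ω) T ^ p) μ := by
    refine ⟨(hQm.pow_const p).aestronglyMeasurable, ?_⟩
    rw [hasFiniteIntegral_iff_ofReal (.of_forall fun ω => Real.rpow_nonneg (sqFun_nonneg _ _) _)]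
    exact lt_top_iff_ne_top.2 hfin
  have hE : Integrable (fun ω => energy (x ω) T ^ p) μ := by
    refine (hQ.const_mul ((3 * T) ^ p)).mono'
      ((measurable_energy fun i s _ => hmeas' i s).pow_const p).aestronglyMeasurable
      (.of_forall fun ω => ?_)
    rw [Real.norm_of_nonneg (Real.rpow_nonneg (energy_nonneg _ _) _),
      ← Real.mul_rpow (by positivity) (sqFun_nonneg _ _)]
    exact Real.rpow_le_rpow (energy_nonneg _ _) (energy_le_mul_sqFun _ (hx0 ω) le_rfl)
      (by linarith)
  -- the terms of the martingale transform are integrable and have mean zero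
  have hterm : ∀ j < T, ∀ i, Integrable (fun ω => inner ℝ
      ((energy (x ω) j ^ (p - 2) * energyFactor (x ω i) j) • N i j ω)
        (N i (j + 1) ω - N i j ω)) μ := by
    intro j hj i
    refine (hQ.const_mul (4 * (3 * j) ^ (p - 1))).mono' ?_ (.of_forall fun ω => ?_)
    · have a1 : Measurable fun ω => energy (x ω) j := measurable_energy fun i s _ => hmeas' i s
      have a2 : Measurable fun ω => energyFactor (x ω i) j :=
        measurable_energyFactor fun s _ => hmeas' i s
      have a3 := ((a1.pow_const (p - 2)).mul a2).smul (hmeas' i j)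
      exact (a3.inner ((hmeas' i (j + 1)).sub (hmeas' i j))).aestronglyMeasurable
    · have b1 := abs_energyFactor_mul_norm_le (x ω i) j
      have b2 : runMax (x ω i) j ≤ energy (x ω) j := by
        refine (sq_le_sq₀ (runMax_nonneg _ _) (energy_nonneg _ _)).1
          (le_trans ?_ (sum_sq_runMax_le_sq_energy (x ω) j))
        exact Finset.single_le_sum (f := fun i => runMax (x ω i) j ^ 2)
          (fun _ _ => by positivity) (Finset.mem_univ i)
      have b3 : ‖N i (j + 1) ω - N i j ω‖ ≤ sqFun (x ω) T := by
        refine le_trans ?_ (sqrt_sqIncr_le_sqFun (x ω) hj)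
        refine Real.le_sqrt_of_sq_le ?_
        exact Finset.single_le_sum (f := fun i => ‖x ω i (j + 1) - x ω i j‖ ^ 2)
          (fun _ _ => by positivity) (Finset.mem_univ i)
      have b4 := energy_le_mul_sqFun (x ω) (hx0 ω) hj.le
      have hE0 := energy_nonneg (x ω) j
      have hQ0 := sqFun_nonneg (x ω) T
      have b5 : energy (x ω) j ^ (p - 2) * (|energyFactor (x ω i) j| * ‖N i j ω‖)
          ≤ 4 * energy (x ω) j ^ (p - 1) := by
        rcases hE0.eq_or_lt with he | he
        · have : runMax (x ω i) j = 0 := le_antisymm (b2.trans he.ge) (runMax_nonneg _ _)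
          have : |energyFactor (x ω i) j| * ‖N i j ω‖ = 0 :=
            le_antisymm (b1.trans (by rw [this]; simp)) (by positivity)
          rw [this, mul_zero]
          exact mul_nonneg (by norm_num) (Real.rpow_nonneg hE0 _)
        · have e1 : energy (x ω) j ^ (p - 1) = energy (x ω) j ^ (p - 2) * energy (x ω) j := by
            rw [← Real.rpow_add_one he.ne']; ring_nf
          rw [e1]
          calc _ ≤ energy (x ω) j ^ (p - 2) * (4 * energy (x ω) j) := by
                refine mul_le_mul_of_nonneg_left (b1.trans ?_) (Real.rpow_nonneg hE0 _)
                linarith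
            _ = _ := by ring
      have b6 : energy (x ω) j ^ (p - 1) ≤ (3 * j) ^ (p - 1) * sqFun (x ω) T ^ (p - 1) := by
        rw [← Real.mul_rpow (by positivity) hQ0]
        exact Real.rpow_le_rpow hE0 b4 (by linarith)
      have b7 : sqFun (x ω) T ^ (p - 1) * sqFun (x ω) T = sqFun (x ω) T ^ p := by
        have := Real.rpow_add_of_nonneg hQ0 (y := p - 1) (z := 1) (by linarith) (by norm_num)
        rw [Real.rpow_one] at this
        rw [← this]; ring_nf
      rw [Real.norm_eq_abs]
      refine (abs_real_inner_le_norm _ _).trans ?_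
      rw [norm_smul, Real.norm_eq_abs, abs_mul, abs_of_nonneg (Real.rpow_nonneg hE0 _), ← b7]
      calc _ = energy (x ω) j ^ (p - 2) * (|energyFactor (x ω i) j| * ‖N i j ω‖)
              * ‖N i (j + 1) ω - N i j ω‖ := by ring
        _ ≤ 4 * ((3 * j) ^ (p - 1) * sqFun (x ω) T ^ (p - 1)) * sqFun (x ω) T := by
            refine mul_le_mul (b5.trans ?_) b3 (norm_nonneg _) (by positivity)
            gcongr
        _ = _ := by ring
  have hzero : ∀ j < T, ∀ i, ∫ ω, inner ℝ
      ((energy (x ω) j ^ (p - 2) * energyFactor (x ω i) j) • N i j ω)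
        (N i (j + 1) ω - N i j ω) ∂μ = 0 := by
    intro j hj i
    have a1 : Measurable[ℱ j] fun ω => energy (x ω) j := measurable_energy (hmeas j)
    have a2 : Measurable[ℱ j] fun ω => energyFactor (x ω i) j :=
      measurable_energyFactor (hmeas j i)
    have a3 : Measurable[ℱ j] fun ω =>
        (energy (x ω) j ^ (p - 2) * energyFactor (x ω i) j) • N i j ω :=
      ((a1.pow_const (p - 2)).mul a2).smul (hmeas j i j le_rfl)
    have a4 := condExp_bilin_increment_eq_zero (hN i) (innerSL ℝ) j a3.stronglyMeasurable
      (hterm j hj i)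
    have a5 := integral_condExp (μ := μ) (ℱ.le j) (f := fun ω => innerSL ℝ
      ((energy (x ω) j ^ (p - 2) * energyFactor (x ω i) j) • N i j ω)
        (N i (j + 1) ω - N i j ω))
    rw [integral_congr_ae a4] at a5
    simpa using a5.symm
  have hsplit : ∀ ω j, energy (x ω) j ^ (p - 2) * energyIncr (x ω) j
      = ∑ i, inner ℝ ((energy (x ω) j ^ (p - 2) * energyFactor (x ω i) j) • N i j ω)
        (N i (j + 1) ω - N i j ω) := by
    intro ω j
    rw [energyIncr, Finset.mul_sum]
    refine Finset.sum_congr rfl fun i _ => ?_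
    rw [real_inner_smul_left, mul_assoc]
  have hYint : Integrable (fun ω => ∑ j ∈ Finset.range T,
      energy (x ω) j ^ (p - 2) * energyIncr (x ω) j) μ := by
    simp only [hsplit]
    exact integrable_finsetSum _ fun j hj => integrable_finsetSum _ fun i _ =>
      hterm j (Finset.mem_range.1 hj) i
  have hY0 : ∫ ω, ∑ j ∈ Finset.range T, energy (x ω) j ^ (p - 2) * energyIncr (x ω) j ∂μ = 0 := by
    simp only [hsplit]
    rw [integral_finsetSum _ fun j hj => integrable_finsetSum _ fun i _ =>
      hterm j (Finset.mem_range.1 hj) i]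
    refine Finset.sum_eq_zero fun j hj => ?_
    rw [integral_finsetSum _ fun i _ => hterm j (Finset.mem_range.1 hj) i]
    exact Finset.sum_eq_zero fun i _ => hzero j (Finset.mem_range.1 hj) i
  have hmain : ∫ ω, energy (x ω) T ^ p ∂μ ≤ C * ∫ ω, sqFun (x ω) T ^ p ∂μ := by
    calc ∫ ω, energy (x ω) T ^ p ∂μ
        ≤ ∫ ω, (p * ∑ j ∈ Finset.range T, energy (x ω) j ^ (p - 2) * energyIncr (x ω) j
          + C * sqFun (x ω) T ^ p) ∂μ :=
          integral_mono hE ((hYint.const_mul p).add (hQ.const_mul C)) fun ω => h (x ω) (hx0 ω) T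
      _ = _ := by
          rw [integral_add (hYint.const_mul p) (hQ.const_mul C), integral_const_mul,
            integral_const_mul, hY0, mul_zero, zero_add]
  rw [← ofReal_integral_eq_lintegral_ofReal hE
      (.of_forall fun ω => Real.rpow_nonneg (energy_nonneg _ _) _),
    ← ofReal_integral_eq_lintegral_ofReal hQ
      (.of_forall fun ω => Real.rpow_nonneg (sqFun_nonneg _ _) _)]
  change _ ≤ ENNReal.ofReal C * _
  rw [← ENNReal.ofReal_mul hC.le]
  exact ENNReal.ofReal_le_ofReal hmain

lemma tsum_sq_iSup_eq {b : ℕ → ℕ → ℝ≥0∞} (hb : ∀ k, Monotone (b k)) :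
    ∑' k, (⨆ t, b k t) ^ (2 : ℝ) = ⨆ K, ∑ k ∈ Finset.range K, b k K ^ (2 : ℝ) := by
  have h2 : ∀ k, (⨆ t, b k t) ^ (2 : ℝ) = ⨆ t, b k t ^ (2 : ℝ) := fun k =>
    (ENNReal.orderIsoRpow 2 (by norm_num)).map_iSup _
  have hmono : ∀ k, Monotone fun t => b k t ^ (2 : ℝ) := fun k s t h =>
    ENNReal.rpow_le_rpow (hb k h) (by norm_num)
  simp only [h2]
  rw [ENNReal.tsum_eq_iSup_nat]
  refine le_antisymm (iSup_le fun K => ?_) (iSup_mono fun K => ?_)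
  · rw [ENNReal.finsetSum_iSup_of_monotone hmono]
    refine iSup_le fun t => le_iSup_of_le (max K t) ?_
    calc _ ≤ ∑ k ∈ Finset.range K, b k (max K t) ^ (2 : ℝ) :=
          Finset.sum_le_sum fun k _ => hmono k (le_max_right _ _)
      _ ≤ _ := Finset.sum_le_sum_of_subset (Finset.range_mono (le_max_left _ _))
  · exact Finset.sum_le_sum fun k _ => le_iSup (fun t => b k t ^ (2 : ℝ)) K

lemma enorm_rpow_two (z : ℂ) : ‖z‖ₑ ^ (2 : ℝ) = ENNReal.ofReal (‖z‖ ^ 2) := by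
  rw [← ofReal_norm, ENNReal.ofReal_rpow_of_nonneg (norm_nonneg _) (by norm_num)]
  norm_num

/-- The `ℓ²`-valued Burkholder–Davis–Gundy inequality for a sequence of martingales. -/
theorem exists_lintegral_tsum_sq_maximal_le (p : ℝ) (hp : 1 ≤ p) :
    ∃ C : ℝ≥0, ∀ {Ω : Type*} {m : MeasurableSpace Ω} {μ : Measure Ω} [IsFiniteMeasure μ]
      {ℱ : Filtration ℕ m} (N : ℕ → ℕ → Ω → ℂ) (_ : ∀ k, Martingale (N k) ℱ μ)
      (_ : ∀ k ω, N k 0 ω = 0),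
      ∫⁻ ω, (∑' k, (⨆ t, ‖N k t ω‖ₑ) ^ (2 : ℝ)) ^ (p / 2) ∂μ
        ≤ C * ∫⁻ ω, (∑' j, ∑' k, ‖N k (j + 1) ω - N k j ω‖ₑ ^ (2 : ℝ)) ^ (p / 2) ∂μ := by
  obtain ⟨C, -, h⟩ := exists_lintegral_energy_le p hp
  refine ⟨C, fun {Ω m μ} _ {ℱ} N hN h0 => ?_⟩
  have hmeas : ∀ k s, Measurable (N k s) := fun k s => (((hN k).1 s).mono (ℱ.le s)).measurable
  have hp2 : 0 < p / 2 := by linarith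
  let b : Ω → ℕ → ℕ → ℝ≥0∞ := fun ω k t => ENNReal.ofReal (runMax (fun s => N k s ω) t)
  have hb : ∀ ω k, Monotone (b ω k) := fun ω k s t hst =>
    ENNReal.ofReal_le_ofReal (runMax_mono _ hst)
  have hbm : ∀ k t, Measurable fun ω => b ω k t := fun k t =>
    (measurable_runMax fun s _ => hmeas k s).ennreal_ofReal
  let F : ℕ → Ω → ℝ≥0∞ := fun K ω => (∑ k ∈ Finset.range K, b ω k K ^ (2 : ℝ)) ^ (p / 2)
  have hFm : ∀ K, Measurable (F K) := fun K =>
    (Finset.measurable_sum _ fun k _ => (hbm k K).pow_const _).pow_const _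
  have hFmono : Monotone F := fun K L hKL ω => by
    refine ENNReal.rpow_le_rpow ?_ hp2.le
    calc _ ≤ ∑ k ∈ Finset.range K, b ω k L ^ (2 : ℝ) :=
          Finset.sum_le_sum fun k _ => ENNReal.rpow_le_rpow (hb ω k hKL) (by norm_num)
      _ ≤ _ := Finset.sum_le_sum_of_subset (Finset.range_mono hKL)
  have hF : ∀ K, ∫⁻ ω, F K ω ∂μ
      ≤ C * ∫⁻ ω, (∑' j, ∑' k, ‖N k (j + 1) ω - N k j ω‖ₑ ^ (2 : ℝ)) ^ (p / 2) ∂μ := by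
    intro K
    have hK := h (fun k : Fin K => N k) (fun k => hN k) (fun k ω => h0 k ω) K
    refine le_trans (lintegral_mono fun ω => ?_) (hK.trans ?_)
    · have e1 : ∑ k ∈ Finset.range K, b ω k K ^ (2 : ℝ)
          = ENNReal.ofReal (∑ k : Fin K, runMax (fun s => N k s ω) K ^ 2) := by
        rw [Fin.sum_univ_eq_sum_range (fun k => runMax (fun s => N k s ω) K ^ 2),
          ENNReal.ofReal_sum_of_nonneg fun _ _ => by positivity]
        refine Finset.sum_congr rfl fun k _ => ?_
        rw [ENNReal.ofReal_rpow_of_nonneg (runMax_nonneg _ _) (by norm_num)]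
        norm_num
      change (∑ k ∈ Finset.range K, b ω k K ^ (2 : ℝ)) ^ (p / 2) ≤ _
      rw [e1, ENNReal.ofReal_rpow_of_nonneg (Finset.sum_nonneg fun _ _ => by positivity) hp2.le]
      refine ENNReal.ofReal_le_ofReal ?_
      have e2 : ∀ z : ℝ, 0 ≤ z → z ^ p = (z ^ 2) ^ (p / 2) := fun z hz => by
        rw [← Real.rpow_natCast, ← Real.rpow_mul hz]; congr 1; push_cast; ring
      rw [e2 _ (energy_nonneg _ _)]
      exact Real.rpow_le_rpow (Finset.sum_nonneg fun _ _ => by positivity)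
        (sum_sq_runMax_le_sq_energy (fun (k : Fin K) t => N k t ω) K) hp2.le
    · gcongr with ω
      have e2 : ∀ z : ℝ, 0 ≤ z → z ^ p = (z ^ 2) ^ (p / 2) := fun z hz => by
        rw [← Real.rpow_natCast, ← Real.rpow_mul hz]; congr 1; push_cast; ring
      rw [e2 _ (sqFun_nonneg _ _), sq_sqFun,
        ← ENNReal.ofReal_rpow_of_nonneg (sum_sqIncr_nonneg _ _) hp2.le]
      refine ENNReal.rpow_le_rpow ?_ hp2.le
      rw [ENNReal.ofReal_sum_of_nonneg fun _ _ => sqIncr_nonneg _ _]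
      refine le_trans (Finset.sum_le_sum fun j _ => ?_) (ENNReal.sum_le_tsum (Finset.range K))
      rw [sqIncr, ENNReal.ofReal_sum_of_nonneg fun _ _ => by positivity]
      simp only [← enorm_rpow_two]
      rw [Fin.sum_univ_eq_sum_range (fun k => ‖N k (j + 1) ω - N k j ω‖ₑ ^ (2 : ℝ))]
      exact ENNReal.sum_le_tsum _
  calc ∫⁻ ω, (∑' k, (⨆ t, ‖N k t ω‖ₑ) ^ (2 : ℝ)) ^ (p / 2) ∂μ
      ≤ ∫⁻ ω, ⨆ K, F K ω ∂μ := by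
        refine lintegral_mono fun ω => ?_
        have e3 : ⨆ K, F K ω = (∑' k, (⨆ t, b ω k t) ^ (2 : ℝ)) ^ (p / 2) := by
          rw [tsum_sq_iSup_eq (hb ω)]
          exact ((ENNReal.orderIsoRpow (p / 2) hp2).map_iSup _).symm
        rw [e3]
        gcongr with k t
        rw [← ofReal_norm]
        exact ENNReal.ofReal_le_ofReal (norm_le_runMax (fun s => N k s ω) le_rfl)
    _ = ⨆ K, ∫⁻ ω, F K ω ∂μ := lintegral_iSup hFm hFmono
    _ ≤ _ := iSup_le hF

/-- The form in which the Burkholder–Davis–Gundy inequality is used: it applies to the pieces of a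
martingale, and of a martingale transform of it, over the intervals of an adapted partition. -/
theorem exists_eLpNorm_transform_le (p : ℝ≥0∞) (hp : 1 ≤ p) (hp' : p < ∞) :
    ∃ C : ℝ≥0, ∀ {Ω : Type*} {m : MeasurableSpace Ω} {μ : Measure Ω} [IsFiniteMeasure μ]
      {ℱ : Filtration ℕ m} {g : ℕ → Ω → ℂ} (_ : Martingale g ℱ μ) (H : ℕ → ℕ → Ω → ℂ)
      (_ : ∀ k j, Measurable[ℱ j] (H k j))
      (_ : ∀ j ω, ∑' k, ‖H k j ω‖ₑ ^ (2 : ℝ) ≤ 1),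
      eLpNorm (fun ω => ellNorm 2 fun k => ⨆ t, ‖transform (H k) g t ω‖ₑ) p μ
        ≤ C * eLpNorm (fun ω => squareFn fun n => g n ω) p μ := by
  have hp1 : 1 ≤ p.toReal := by
    rw [← ENNReal.toReal_one]
    exact (ENNReal.toReal_le_toReal ENNReal.one_ne_top hp'.ne).2 hp
  obtain ⟨C, h⟩ := exists_lintegral_tsum_sq_maximal_le p.toReal hp1
  refine ⟨C ^ (1 / p.toReal), fun {Ω m μ} _ {ℱ g} hg H hH hH1 => ?_⟩
  have hp0 : p ≠ 0 := (zero_lt_one.trans_le hp).ne'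
  have hb : ∀ k j ω, ‖H k j ω‖ ≤ 1 := by
    intro k j ω
    have h1 : ‖H k j ω‖ₑ ^ (2 : ℝ) ≤ 1 :=
      (ENNReal.le_tsum (f := fun k => ‖H k j ω‖ₑ ^ (2 : ℝ)) k).trans (hH1 j ω)
    by_contra hlt
    refine absurd (ENNReal.one_lt_rpow ?_ (by norm_num : (0 : ℝ) < 2)) h1.not_gt
    rw [← ofReal_norm, ENNReal.one_lt_ofReal]
    exact not_le.1 hlt
  have h1 := h (fun k => transform (H k) g) (fun k => martingale_transform hg (hH k) (hb k))
    (fun k ω => by simp [transform])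
  rw [eLpNorm_eq_lintegral_rpow_enorm_toReal hp0 hp'.ne,
    eLpNorm_eq_lintegral_rpow_enorm_toReal hp0 hp'.ne,
    ENNReal.coe_rpow_of_nonneg _ (by positivity), ← ENNReal.mul_rpow_of_nonneg _ _ (by positivity)]
  refine ENNReal.rpow_le_rpow ?_ (by positivity)
  have e : ∀ z : ℝ≥0∞, (z ^ (1 / 2 : ℝ)) ^ p.toReal = z ^ (p.toReal / 2) := fun z => by
    rw [← ENNReal.rpow_mul]; congr 1; ring
  have e2 : ((2 : ℝ≥0∞)).toReal = 2 := by simp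
  simp only [ellNorm, ENNReal.ofNat_ne_top, if_false, enorm_eq_self, e2, e, squareFn]
  refine h1.trans ?_
  gcongr with ω j
  simp only [transform_succ_sub, enorm_mul]
  calc ∑' k, (‖H k j ω‖ₑ * ‖g (j + 1) ω - g j ω‖ₑ) ^ (2 : ℝ)
      = (∑' k, ‖H k j ω‖ₑ ^ (2 : ℝ)) * ‖g (j + 1) ω - g j ω‖ₑ ^ (2 : ℝ) := by
        rw [← ENNReal.tsum_mul_right]
        exact tsum_congr fun k => ENNReal.mul_rpow_of_nonneg _ _ (by norm_num)
    _ ≤ 1 * ‖g (j + 1) ω - g j ω‖ₑ ^ (2 : ℝ) := by gcongr; exact hH1 j ω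
    _ = _ := one_mul _

end Martingale

/-! ### Sequence norms and the inequality of Hölder -/

section Norms

lemma ellNorm_eq_eLpNorm {r : ℝ≥0∞} (hr : r ≠ 0) (a : ℕ → ℝ≥0∞) :
    ellNorm r a = eLpNorm a r (Measure.count : Measure ℕ) := by
  rw [ellNorm]
  split_ifs with h
  · subst h; simp
  · rw [eLpNorm_eq_lintegral_rpow_enorm_toReal hr h, lintegral_count]
    simp

lemma ellNorm_mono (r : ℝ≥0∞) {a b : ℕ → ℝ≥0∞} (h : ∀ k, a k ≤ b k) :
    ellNorm r a ≤ ellNorm r b := by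
  unfold ellNorm
  split_ifs
  · exact iSup_mono h
  · gcongr with k
    exact h k

lemma measurable_ellNorm {Ω : Type*} {m : MeasurableSpace Ω} (r : ℝ≥0∞) {a : ℕ → Ω → ℝ≥0∞}
    (h : ∀ k, Measurable (a k)) : Measurable fun ω => ellNorm r fun k => a k ω := by
  unfold ellNorm
  split_ifs
  · exact .iSup h
  · exact (Measurable.tsum fun k => (h k).pow_const _).pow_const _

/-- Hölder's inequality for functions with values in `[0, ∞]`, in the full range of exponents. -/
lemma eLpNorm_mul_le_of_holder {Ω : Type*} {m : MeasurableSpace Ω} {μ : Measure Ω}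
    {q q₀ q₁ : ℝ≥0∞} (hq₀ : q₀ ≠ 0) (hq₀' : q₀ ≠ ∞) (hq₁ : q₁ ≠ 0)
    (h : 1 / q = 1 / q₀ + 1 / q₁) {a b : Ω → ℝ≥0∞} (ha : Measurable a) (hb : Measurable b) :
    eLpNorm (fun ω => a ω * b ω) q μ ≤ eLpNorm a q₁ μ * eLpNorm b q₀ μ := by
  rcases eq_or_ne q₁ ∞ with rfl | hq₁'
  · have hq : q = q₀ := by simpa using h
    subst hq
    rw [eLpNorm_exponent_top, eLpNorm_eq_lintegral_rpow_enorm_toReal hq₀ hq₀',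
      eLpNorm_eq_lintegral_rpow_enorm_toReal hq₀ hq₀']
    have hpos := ENNReal.toReal_pos hq₀ hq₀'
    have e : eLpNormEssSup a μ = (eLpNormEssSup a μ ^ q.toReal) ^ (1 / q.toReal) := by
      rw [one_div, ENNReal.rpow_rpow_inv hpos.ne']
    rw [e, ← ENNReal.mul_rpow_of_nonneg _ _ (by positivity)]
    refine ENNReal.rpow_le_rpow ?_ (by positivity)
    rw [← lintegral_const_mul _ (by simpa using hb.pow_const _)]
    refine lintegral_mono_ae ?_
    filter_upwards [enorm_ae_le_eLpNormEssSup a μ] with ω hω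
    simp only [enorm_eq_self] at hω ⊢
    rw [ENNReal.mul_rpow_of_nonneg _ _ hpos.le]
    gcongr
  · have h0 := ENNReal.toReal_pos hq₀ hq₀'
    have h1 := ENNReal.toReal_pos hq₁ hq₁'
    have hq0 : q ≠ 0 := by
      rintro rfl
      simp only [one_div, ENNReal.inv_zero] at h
      have := ENNReal.add_ne_top.2 ⟨ENNReal.inv_ne_top.2 hq₀, ENNReal.inv_ne_top.2 hq₁⟩
      exact this h.symm
    have hqt : q ≠ ∞ := by
      rintro rfl
      simp only [one_div, ENNReal.inv_top] at h
      have := (add_eq_zero.1 h.symm).1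
      exact hq₀' (ENNReal.inv_eq_zero.1 this)
    have hr : 1 / q.toReal = 1 / q₀.toReal + 1 / q₁.toReal := by
      have := congrArg ENNReal.toReal h
      rw [ENNReal.toReal_add (by simpa using hq₀) (by simpa using hq₁)] at this
      simpa using this
    have hqpos := ENNReal.toReal_pos hq0 hqt
    have hlt : q.toReal < q₁.toReal := by
      have : 1 / q₁.toReal < 1 / q.toReal := by rw [hr]; linarith [one_div_pos.2 h0]
      exact (one_div_lt_one_div h1 hqpos).1 this
    rw [eLpNorm_eq_lintegral_rpow_enorm_toReal hq0 hqt,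
      eLpNorm_eq_lintegral_rpow_enorm_toReal hq₀ hq₀',
      eLpNorm_eq_lintegral_rpow_enorm_toReal hq₁ hq₁']
    simpa using ENNReal.lintegral_Lp_mul_le_Lq_mul_Lr hqpos hlt (by rw [hr, add_comm]) μ
      ha.aemeasurable hb.aemeasurable

end Norms

/-! ### Summation by parts for the paraproduct -/

section Pathwise

lemma ofReal_runMax_le {x : ℕ → ℂ} {t : ℕ} {B : ℝ≥0∞} (h : ∀ s ≤ t, ‖x s‖ₑ ≤ B) :
    ENNReal.ofReal (runMax x t) ≤ B := by
  induction t with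
  | zero => simpa [runMax] using h 0 le_rfl
  | succ t ih =>
    rw [runMax_succ, ENNReal.ofReal_max, ofReal_norm]
    exact max_le (ih fun s hs => h s (hs.trans (Nat.le_succ t))) (h _ le_rfl)

lemma paraproduct_succ (F : ℕ → ℕ → ℂ) (g : ℕ → ℂ) {s t : ℕ} (h : s ≤ t) :
    paraproduct F g s (t + 1) = paraproduct F g s t + F s t * (g (t + 1) - g t) := by
  simp [paraproduct, Finset.sum_Ioc_succ_top h]

lemma paraproduct_of_le (F : ℕ → ℕ → ℂ) (g : ℕ → ℂ) {s t : ℕ} (h : t ≤ s) :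
    paraproduct F g s t = 0 := by
  simp [paraproduct, Finset.Ioc_eq_empty_of_le h]

/-- Pathwise bound for the paraproduct over `[s, t]`. Here `x` follows `g`, and `y` is `g`
integrated against the normalized increments `(f - f a) / A`; summation by parts, `A` being
nondecreasing, recovers the integral of `f - f a` from `y`. -/
lemma norm_paraproduct_le {f g x y : ℕ → ℂ} {A : ℕ → ℝ} {X Y : ℝ} {a s t : ℕ} (hst : s < t)
    (hx : ∀ j, s ≤ j → j < t → x (j + 1) - x j = g (j + 1) - g j)
    (hy : ∀ j, s ≤ j → j < t → A j * (y (j + 1) - y j) = (f j - f a) * (g (j + 1) - g j))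
    (hA : Monotone A) (hA0 : ∀ j, 0 ≤ A j) (hfs : ‖f s - f a‖ ≤ A s)
    (hX : ∀ j ≤ t, ‖x j‖ ≤ X) (hY : ∀ j ≤ t, ‖y j‖ ≤ Y) :
    ‖paraproduct (delta f) g s t‖ ≤ 2 * A (t - 1) * (X + Y) := by
  let S : ℕ → ℂ := fun n => ∑ j ∈ Finset.Ico s n, A j * (y (j + 1) - y j)
  have hS : ∀ n, s ≤ n → S (n + 1) = S n + A n * (y (n + 1) - y n) := fun n hn =>
    Finset.sum_Ico_succ_top hn _
  have h1 : ∀ n, s ≤ n → n ≤ t →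
      paraproduct (delta f) g s n = S n - (f s - f a) * (x n - x s) := by
    intro n hn
    induction n, hn using Nat.le_induction with
    | base => intro _; simp [paraproduct, S]
    | succ n hn ih =>
      intro hnt
      rw [paraproduct_succ _ _ hn, ih (Nat.le_of_succ_le hnt), hS n hn, hy n hn hnt, delta,
        ← hx n hn hnt]
      ring
  have h2 : ∀ n, s ≤ n → n + 1 ≤ t → ‖S (n + 1) - A n * y (n + 1)‖ ≤ A n * Y := by
    intro n hn
    induction n, hn using Nat.le_induction with
    | base =>
      intro hnt
      have : S (s + 1) - A s * y (s + 1) = -(A s * y s) := by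
        rw [hS s le_rfl]; simp only [S, Finset.Ico_self, Finset.sum_empty]; ring
      rw [this, norm_neg, norm_mul, Complex.norm_of_nonneg (hA0 s)]
      exact mul_le_mul_of_nonneg_left (hY s (Nat.le_of_succ_le hnt)) (hA0 s)
    | succ n hn ih =>
      intro hnt
      have h3 := ih (Nat.le_of_succ_le hnt)
      have h4 : 0 ≤ A (n + 1) - A n := sub_nonneg.2 (hA (Nat.le_succ n))
      have : S (n + 1 + 1) - A (n + 1) * y (n + 1 + 1)
          = (S (n + 1) - A n * y (n + 1)) - ((A (n + 1) - A n : ℝ) : ℂ) * y (n + 1) := by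
        rw [hS (n + 1) (Nat.le_succ_of_le hn)]; push_cast; ring
      rw [this]
      refine (norm_sub_le _ _).trans ?_
      rw [norm_mul, Complex.norm_of_nonneg h4]
      have := mul_le_mul_of_nonneg_left (hY (n + 1) (Nat.le_of_succ_le hnt)) h4
      linarith
  obtain ⟨n, rfl⟩ : ∃ n, t = n + 1 := ⟨t - 1, by omega⟩
  have hsn : s ≤ n := by omega
  rw [h1 (n + 1) hst.le le_rfl, Nat.add_sub_cancel]
  have e1 := h2 n hsn le_rfl
  have e2 : ‖(A n : ℂ) * y (n + 1)‖ ≤ A n * Y := by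
    rw [norm_mul, Complex.norm_of_nonneg (hA0 n)]
    exact mul_le_mul_of_nonneg_left (hY _ le_rfl) (hA0 n)
  have e3 : ‖(f s - f a) * (x (n + 1) - x s)‖ ≤ A n * (2 * X) := by
    rw [norm_mul]
    refine mul_le_mul (hfs.trans (hA hsn)) ?_ (norm_nonneg _) (hA0 n)
    have := norm_sub_le (x (n + 1)) (x s)
    have := hX (n + 1) le_rfl
    have := hX s hst.le
    linarith
  have e4 : ‖S (n + 1)‖ ≤ 2 * (A n * Y) := by
    have := norm_add_le (S (n + 1) - A n * y (n + 1)) (A n * y (n + 1))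
    rw [sub_add_cancel] at this
    linarith
  have := norm_sub_le (S (n + 1)) ((f s - f a) * (x (n + 1) - x s))
  linarith

end Pathwise

/-! ### The maximal estimate over adapted partitions -/

section Partition

/-- The value of a stopping time which is known to be finite. -/
lemma untopA_some (a : ℕ) : WithTop.untopA (WithTop.some a) = a := rfl

variable {Ω : Type*} {m : MeasurableSpace Ω} {ℱ : Filtration ℕ m} {τ : ℕ → Ω → WithTop ℕ}

/-- The running maximum, up to time `j`, of `‖f t - f a‖` over `t ≥ a`. -/
noncomputable def devMax (f : ℕ → ℂ) (a j : ℕ) : ℝ :=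
  runMax (fun t => if a ≤ t then f t - f a else 0) j

open Classical in
/-- The function `φ a` at `a = τ_k`, restricted to the event `τ_k ≤ j < τ_{k+1}` that the step from
`j` to `j + 1` belongs to the `k`-th interval of the partition. -/
noncomputable def onInterval {β : Type*} [Zero β] (τ : ℕ → Ω → WithTop ℕ) (φ : ℕ → Ω → β)
    (k j : ℕ) (ω : Ω) : β :=
  if τ k ω ≤ j ∧ (j : WithTop ℕ) < τ (k + 1) ω then φ (τ k ω).untopA ω else 0

lemma measurable_onInterval {β : Type*} [AddCommMonoid β] [MeasurableSpace β] [MeasurableAdd₂ β]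
    (hτ : IsAdaptedPartition ℱ τ) {φ : ℕ → Ω → β} (k j : ℕ)
    (hφ : ∀ a ≤ j, Measurable[ℱ j] (φ a)) : Measurable[ℱ j] (onInterval τ φ k j) := by
  classical
  have e : onInterval τ φ k j = fun ω => ∑ a ∈ Finset.range (j + 1),
      if τ k ω = a ∧ (j : WithTop ℕ) < τ (k + 1) ω then φ a ω else 0 := by
    ext ω
    unfold onInterval
    split_ifs with h
    · obtain ⟨a, ha⟩ := WithTop.ne_top_iff_exists.1 (ne_top_of_le_ne_top (WithTop.coe_ne_top) h.1)
      have haj : a ≤ j := by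
        have := h.1
        rw [← ha] at this
        exact WithTop.coe_le_coe.1 this
      rw [← ha, Finset.sum_eq_single a]
      · rw [if_pos ⟨rfl, h.2⟩, untopA_some]
      · intro b _ hb
        rw [if_neg]
        rintro ⟨h1, -⟩
        exact hb (WithTop.coe_injective h1).symm
      · intro h1
        exact absurd (Finset.mem_range.2 (Nat.lt_succ_of_le haj)) h1
    · refine (Finset.sum_eq_zero fun a ha => if_neg ?_).symm
      rintro ⟨h1, h2⟩
      refine h ⟨?_, h2⟩
      rw [h1]
      exact WithTop.coe_le_coe.2 (Nat.lt_succ_iff.1 (Finset.mem_range.1 ha))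
  rw [e]
  refine Finset.measurable_sum _ fun a ha => ?_
  have haj : a ≤ j := Nat.lt_succ_iff.1 (Finset.mem_range.1 ha)
  refine Measurable.ite ?_ (hφ a haj) measurable_const
  have h1 : MeasurableSet[ℱ j] {ω | τ k ω = a} :=
    ℱ.mono haj _ ((hτ.isStoppingTime k).measurableSet_eq a)
  have h2 : MeasurableSet[ℱ j] {ω | (j : WithTop ℕ) < τ (k + 1) ω} :=
    (hτ.isStoppingTime (k + 1)).measurableSet_gt j
  exact h1.inter h2

lemma tsum_enorm_onInterval_le (hτ : IsAdaptedPartition ℱ τ) {φ : ℕ → Ω → ℂ}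
    (j : ℕ) (hφ : ∀ a ω, ‖φ a ω‖ ≤ 1) (ω : Ω) :
    ∑' k, ‖onInterval τ φ k j ω‖ₑ ^ (2 : ℝ) ≤ 1 := by
  by_cases h : ∃ k, τ k ω ≤ j ∧ (j : WithTop ℕ) < τ (k + 1) ω
  · obtain ⟨k, hk⟩ := h
    rw [tsum_eq_single k]
    · refine ENNReal.rpow_le_one ?_ (by norm_num)
      rw [onInterval, if_pos hk, ← ofReal_norm, ENNReal.ofReal_le_one]
      exact hφ _ _
    · intro l hl
      rw [onInterval, if_neg]
      · simp
      rintro ⟨h1, h2⟩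
      rcases lt_or_gt_of_ne hl with h3 | h3
      · exact absurd (h2.trans_le ((hτ.mono ω h3).trans hk.1)) (lt_irrefl _)
      · exact absurd (hk.2.trans_le ((hτ.mono ω h3).trans h1)) (lt_irrefl _)
  · push Not at h
    have : ∀ k, onInterval τ φ k j ω = 0 := fun k => if_neg fun h1 => (h k h1.1).not_gt h1.2
    simp [this]

lemma measurable_devMax {f : ℕ → Ω → ℂ} (hf : Adapted ℱ f) {a j : ℕ} (haj : a ≤ j) :
    Measurable[ℱ j] fun ω => devMax (fun n => f n ω) a j := by
  refine measurable_runMax (x := fun t ω => if a ≤ t then f t ω - f a ω else 0) fun s hs => ?_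
  split_ifs
  · exact (hf.measurable_le hs).sub (hf.measurable_le haj)
  · exact measurable_const

/-- The largest deviation of `f` from its value at the left endpoint of the `k`-th interval. -/
noncomputable def deviation (f : ℕ → Ω → ℂ) (τ : ℕ → Ω → WithTop ℕ) (k : ℕ) (ω : Ω) : ℝ≥0∞ :=
  ⨆ (t : ℕ) (_ : τ k ω ≤ t ∧ t < τ (k + 1) ω), ‖f t ω - stoppedValue f (τ k) ω‖ₑ

/-- The largest paraproduct over a subinterval of the `k`-th interval. -/
noncomputable def paraproductMax (f g : ℕ → Ω → ℂ) (τ : ℕ → Ω → WithTop ℕ) (k : ℕ) (ω : Ω) :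
    ℝ≥0∞ :=
  ⨆ (s : ℕ) (t : ℕ) (_ : τ k ω ≤ s ∧ s ≤ t ∧ t ≤ τ (k + 1) ω),
    ‖paraproduct (delta fun n => f n ω) (fun n => g n ω) s t‖ₑ

lemma measurable_deviation (hτ : IsAdaptedPartition ℱ τ) {f : ℕ → Ω → ℂ} (hf : Adapted ℱ f)
    (k : ℕ) : Measurable (deviation f τ k) := by
  have e : deviation f τ k
      = fun ω => ⨆ t, onInterval τ (fun a ω => ‖f t ω - f a ω‖ₑ) k t ω := by
    ext ω
    unfold deviation onInterval
    refine iSup_congr fun t => ?_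
    split_ifs with h
    · simp [h, stoppedValue]
    · simp [h]
  rw [e]
  refine .iSup fun t => ?_
  have h : Measurable[ℱ t] (onInterval τ (fun a ω => ‖f t ω - f a ω‖ₑ) k t) :=
    measurable_onInterval hτ k t fun a ha =>
      measurable_enorm.comp ((hf t).sub (hf.measurable_le ha))
  exact h.mono (ℱ.le t) le_rfl

lemma measurable_paraproduct {f g : ℕ → Ω → ℂ} (hf : Adapted ℱ f) (hg : Adapted ℱ g)
    {s t n : ℕ} (ht : t ≤ n) :
    Measurable[ℱ n] fun ω => paraproduct (delta fun n => f n ω) (fun n => g n ω) s t := by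
  refine Finset.measurable_sum _ fun j hj => ?_
  rw [Finset.mem_Ioc] at hj
  exact ((hf.measurable_le (by omega)).sub (hf.measurable_le (by omega))).mul
    ((hg.measurable_le (by omega)).sub (hg.measurable_le (by omega)))

lemma measurable_paraproductMax (hτ : IsAdaptedPartition ℱ τ) {f g : ℕ → Ω → ℂ}
    (hf : Adapted ℱ f) (hg : Adapted ℱ g) (k : ℕ) : Measurable (paraproductMax f g τ k) := by
  classical
  have e : paraproductMax f g τ k = fun ω => ⨆ (s : ℕ) (t : ℕ),
      if τ k ω ≤ s ∧ s ≤ t ∧ t ≤ τ (k + 1) ω then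
        ‖paraproduct (delta fun n => f n ω) (fun n => g n ω) s t‖ₑ else 0 := by
    ext ω
    unfold paraproductMax
    refine iSup_congr fun s => iSup_congr fun t => ?_
    split_ifs with h <;> simp [h]
  rw [e]
  refine .iSup fun s => .iSup fun t => Measurable.ite ?_
    ((measurable_paraproduct hf hg le_rfl).mono (ℱ.le t) le_rfl).enorm measurable_const
  have h1 : MeasurableSet {ω | τ k ω ≤ s} := ℱ.le s _ ((hτ.isStoppingTime k).measurableSet_le s)
  have h2 : MeasurableSet {ω | (t : WithTop ℕ) ≤ τ (k + 1) ω} :=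
    ℱ.le t _ ((hτ.isStoppingTime (k + 1)).measurableSet_ge t)
  exact h1.inter ((MeasurableSet.const (s ≤ t)).inter h2)

/-- The pieces of the martingale `g` over the intervals of the partition are the transforms of `g`
with these factors. -/
noncomputable def pieceFactor (τ : ℕ → Ω → WithTop ℕ) (k j : ℕ) : Ω → ℂ :=
  onInterval τ (fun _ _ => 1) k j

/-- The normalized deviations of `f`, which are bounded by `1`. The condition `a ≤ j` holds on the
interval; it makes the bound valid for all `a`. -/
noncomputable def deviationFactor (f : ℕ → Ω → ℂ) (τ : ℕ → Ω → WithTop ℕ) (k j : ℕ) : Ω → ℂ :=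
  onInterval τ (fun a ω => if a ≤ j then
    (f j ω - f a ω) / (devMax (fun n => f n ω) a j : ℂ) else 0) k j

lemma norm_sub_le_devMax (f : ℕ → ℂ) {a j : ℕ} (h : a ≤ j) : ‖f j - f a‖ ≤ devMax f a j := by
  have := norm_le_runMax (fun t => if a ≤ t then f t - f a else 0) (le_refl j)
  rwa [if_pos h] at this

lemma devMax_nonneg (f : ℕ → ℂ) (a j : ℕ) : 0 ≤ devMax f a j := runMax_nonneg _ _

lemma norm_deviation_quotient_le (f : ℕ → ℂ) (a j : ℕ) :
    ‖if a ≤ j then (f j - f a) / (devMax f a j : ℂ) else 0‖ ≤ 1 := by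
  split_ifs with h
  · rw [norm_div, Complex.norm_of_nonneg (devMax_nonneg _ _ _)]
    exact div_le_one_of_le₀ (norm_sub_le_devMax f h) (devMax_nonneg _ _ _)
  · simp

/-- The maximal estimate pathwise and for a single interval: the deviation of `f` separates from
maximal functions of transforms of `g` with factors bounded by `1`. -/
lemma paraproductMax_le (f g : ℕ → Ω → ℂ) (k : ℕ) (ω : Ω) :
    paraproductMax f g τ k ω ≤ deviation f τ k ω
      * (2 * ((⨆ t, ‖transform (pieceFactor τ k) g t ω‖ₑ)
        + ⨆ t, ‖transform (deviationFactor f τ k) g t ω‖ₑ)) := by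
  refine iSup_le fun s => iSup_le fun t => iSup_le fun ⟨h1, h2, h3⟩ => ?_
  rcases h2.eq_or_lt with rfl | hst
  · simp [paraproduct_of_le]
  obtain ⟨a, ha⟩ := WithTop.ne_top_iff_exists.1 (ne_top_of_le_ne_top (WithTop.coe_ne_top) h1)
  have has : a ≤ s := by rw [← ha] at h1; exact WithTop.coe_le_coe.1 h1
  have hact : ∀ j, s ≤ j → j < t → (τ k ω ≤ j ∧ (j : WithTop ℕ) < τ (k + 1) ω) := fun j hs ht =>
    ⟨h1.trans (WithTop.coe_le_coe.2 hs), (WithTop.coe_lt_coe.2 ht).trans_le h3⟩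
  set F : ℕ → ℂ := fun n => f n ω
  set x : ℕ → ℂ := fun n => transform (pieceFactor τ k) g n ω
  set y : ℕ → ℂ := fun n => transform (deviationFactor f τ k) g n ω
  have key := norm_paraproduct_le (f := F) (g := fun n => g n ω) (x := x) (y := y)
    (A := devMax F a) (X := runMax x t) (Y := runMax y t) (a := a) hst
    (fun j hs ht => by
      simp only [x]
      rw [transform_succ_sub, pieceFactor, onInterval, if_pos (hact j hs ht), one_mul])
    (fun j hs ht => by
      simp only [y]
      rw [transform_succ_sub, deviationFactor, onInterval, if_pos (hact j hs ht), ← ha,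
        untopA_some, if_pos (has.trans hs), ← mul_assoc]
      congr 1
      -- where the normalization divides by zero, the increment of `f` vanishes as well
      rcases (devMax_nonneg F a j).eq_or_lt with h | h
      · have : F j - F a = 0 := norm_le_zero_iff.1
          ((norm_sub_le_devMax F (has.trans hs)).trans h.ge)
        rw [← h, this]; simp
      · exact mul_div_cancel₀ _ (Complex.ofReal_ne_zero.2 h.ne'))
    (runMax_mono _) (devMax_nonneg F a) (norm_sub_le_devMax F has)
    (fun j hj => norm_le_runMax x hj) (fun j hj => norm_le_runMax y hj)
  have hD : ENNReal.ofReal (devMax F a (t - 1)) ≤ deviation f τ k ω := by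
    refine ofReal_runMax_le fun j hj => ?_
    split_ifs with haj
    · refine le_iSup₂_of_le (f := fun (t : ℕ) (_ : τ k ω ≤ t ∧ t < τ (k + 1) ω) =>
        ‖f t ω - stoppedValue f (τ k) ω‖ₑ) j ⟨?_, ?_⟩ ?_
      · rw [← ha]; exact WithTop.coe_le_coe.2 haj
      · exact (WithTop.coe_lt_coe.2 (by omega : j < t)).trans_le h3
      · rw [stoppedValue, ← ha, untopA_some]
    · simp
  have hX : ENNReal.ofReal (runMax x t) ≤ ⨆ n, ‖x n‖ₑ :=
    ofReal_runMax_le fun n _ => le_iSup (fun n => ‖x n‖ₑ) n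
  have hY : ENNReal.ofReal (runMax y t) ≤ ⨆ n, ‖y n‖ₑ :=
    ofReal_runMax_le fun n _ => le_iSup (fun n => ‖y n‖ₑ) n
  rw [← ofReal_norm]
  refine (ENNReal.ofReal_le_ofReal key).trans ?_
  rw [mul_comm (2 : ℝ), mul_assoc, ENNReal.ofReal_mul (devMax_nonneg _ _ _),
    ENNReal.ofReal_mul (by norm_num), ENNReal.ofReal_add (runMax_nonneg _ _) (runMax_nonneg _ _)]
  have e2 : ENNReal.ofReal 2 = 2 := by simp
  rw [e2]
  exact mul_le_mul' hD (mul_le_mul' le_rfl (add_le_add hX hY))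

/-- The maximal estimate over adapted partitions. The exponent `r`, determined by `r₁`, is allowed
to be smaller than `1`, as the variation norm estimate requires. -/
theorem exists_eLpNorm_paraproductMax_le {q q₀ q₁ r r₁ : ℝ≥0∞} (hq₁ : 0 < q₁) (hq₀ : 1 ≤ q₀)
    (hq₀' : q₀ < ∞) (hr₁ : 1 ≤ r₁) (hq : 1 / q = 1 / q₀ + 1 / q₁) (hr : 1 / r = 1 / 2 + 1 / r₁) :
    ∃ C : ℝ≥0, ∀ {Ω : Type*} {m : MeasurableSpace Ω} {μ : Measure Ω} [IsProbabilityMeasure μ]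
      {ℱ : Filtration ℕ m} {f g : ℕ → Ω → ℂ} {τ : ℕ → Ω → WithTop ℕ},
      Adapted ℱ f → Martingale g ℱ μ → IsAdaptedPartition ℱ τ →
      eLpNorm (fun ω => ellNorm r fun k => paraproductMax f g τ k ω) q μ
        ≤ C * eLpNorm (fun ω => ellNorm r₁ fun k => deviation f τ k ω) q₁ μ
          * eLpNorm (fun ω => squareFn fun n => g n ω) q₀ μ := by
  obtain ⟨C, hC⟩ := exists_eLpNorm_transform_le q₀ hq₀ hq₀'
  refine ⟨4 * C, fun {Ω m μ} _ {ℱ f g τ} hf hg hτ => ?_⟩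
  have hr0 : r ≠ 0 := by
    rintro rfl
    simp only [one_div, ENNReal.inv_zero] at hr
    have h1 : (2 : ℝ≥0∞)⁻¹ ≠ ∞ := by simp
    exact ENNReal.add_ne_top.2 ⟨h1, ENNReal.inv_ne_top.2 (zero_lt_one.trans_le hr₁).ne'⟩ hr.symm
  have hga : Adapted ℱ g := hg.1.adapted
  let X : ℕ → Ω → ℝ≥0∞ := fun k ω => ⨆ t, ‖transform (pieceFactor τ k) g t ω‖ₑ
  let Y : ℕ → Ω → ℝ≥0∞ := fun k ω => ⨆ t, ‖transform (deviationFactor f τ k) g t ω‖ₑ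
  have hH1 : ∀ k j, Measurable[ℱ j] (pieceFactor τ k j) := fun k j =>
    measurable_onInterval hτ k j fun _ _ => measurable_const
  have hH2 : ∀ k j, Measurable[ℱ j] (deviationFactor f τ k j) := fun k j =>
    measurable_onInterval hτ k j fun a ha => by
      simp only [ha, if_true]
      exact ((hf j).sub (hf.measurable_le ha)).div
        (Complex.measurable_ofReal.comp (measurable_devMax hf ha))
  have htm : ∀ H : ℕ → Ω → ℂ, (∀ j, Measurable[ℱ j] (H j)) → ∀ t, Measurable (transform H g t) :=
    fun H hH t => Finset.measurable_sum _ fun j _ => ((hH j).mono (ℱ.le j) le_rfl).mul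
      (hga.measurable.sub hga.measurable)
  have hXm : ∀ k, Measurable (X k) := fun k => .iSup fun t => (htm _ (hH1 k) t).enorm
  have hYm : ∀ k, Measurable (Y k) := fun k => .iSup fun t => (htm _ (hH2 k) t).enorm
  have hX := hC hg (fun k => pieceFactor τ k) hH1
    (fun j ω => tsum_enorm_onInterval_le hτ j (fun _ _ => by simp) ω)
  have hY := hC hg (fun k => deviationFactor f τ k) hH2
    (fun j ω => tsum_enorm_onInterval_le hτ j
      (fun a ω => norm_deviation_quotient_le (fun n => f n ω) a j) ω)
  set EX : Ω → ℝ≥0∞ := fun ω => ellNorm 2 fun k => X k ω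
  set EY : Ω → ℝ≥0∞ := fun ω => ellNorm 2 fun k => Y k ω
  set ED : Ω → ℝ≥0∞ := fun ω => ellNorm r₁ fun k => deviation f τ k ω
  have hEX : Measurable EX := measurable_ellNorm 2 hXm
  have hEY : Measurable EY := measurable_ellNorm 2 hYm
  have hED : Measurable ED := measurable_ellNorm r₁ (measurable_deviation hτ hf)
  have hpath : ∀ ω, ellNorm r (fun k => paraproductMax f g τ k ω)
      ≤ ED ω * ((EX ω + EX ω) + (EY ω + EY ω)) := by
    intro ω
    refine (ellNorm_mono r fun k => paraproductMax_le f g k ω).trans ?_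
    rw [ellNorm_eq_eLpNorm hr0]
    refine (eLpNorm_mul_le_of_holder (q₀ := 2) (q₁ := r₁) (by norm_num) (by norm_num)
      (zero_lt_one.trans_le hr₁).ne' hr (measurable_of_countable _)
      (measurable_of_countable _)).trans ?_
    rw [← ellNorm_eq_eLpNorm (zero_lt_one.trans_le hr₁).ne']
    refine mul_le_mul' le_rfl ?_
    have e : (fun k => 2 * ((⨆ t, ‖transform (pieceFactor τ k) g t ω‖ₑ)
        + ⨆ t, ‖transform (deviationFactor f τ k) g t ω‖ₑ))
        = ((fun k => X k ω) + fun k => X k ω) + ((fun k => Y k ω) + fun k => Y k ω) := by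
      ext k
      simp only [Pi.add_apply, X, Y]
      ring
    have hm : ∀ a : ℕ → ℝ≥0∞, AEStronglyMeasurable a (Measure.count : Measure ℕ) := fun a =>
      (measurable_of_countable a).aestronglyMeasurable
    have h2 : (1 : ℝ≥0∞) ≤ 2 := by norm_num
    rw [e]
    simp only [EX, EY, ellNorm_eq_eLpNorm (two_ne_zero : (2 : ℝ≥0∞) ≠ 0)]
    exact (eLpNorm_add_le (hm _) (hm _) h2).trans
      (add_le_add (eLpNorm_add_le (hm _) (hm _) h2) (eLpNorm_add_le (hm _) (hm _) h2))
  calc eLpNorm (fun ω => ellNorm r fun k => paraproductMax f g τ k ω) q μ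
      ≤ eLpNorm (fun ω => ED ω * ((EX ω + EX ω) + (EY ω + EY ω))) q μ :=
        eLpNorm_mono_enorm fun ω => by simpa using hpath ω
    _ ≤ eLpNorm ED q₁ μ * eLpNorm (fun ω => (EX ω + EX ω) + (EY ω + EY ω)) q₀ μ :=
        eLpNorm_mul_le_of_holder (zero_lt_one.trans_le hq₀).ne' hq₀'.ne hq₁.ne' hq hED
          ((hEX.add hEX).add (hEY.add hEY))
    _ ≤ eLpNorm ED q₁ μ * ((eLpNorm EX q₀ μ + eLpNorm EX q₀ μ)
          + (eLpNorm EY q₀ μ + eLpNorm EY q₀ μ)) := by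
        refine mul_le_mul' le_rfl ?_
        have hX' := hEX.aestronglyMeasurable (μ := μ)
        have hY' := hEY.aestronglyMeasurable (μ := μ)
        exact (eLpNorm_add_le (f := EX + EX) (g := EY + EY) (hX'.add hX') (hY'.add hY') hq₀).trans
          (add_le_add (eLpNorm_add_le hX' hX' hq₀) (eLpNorm_add_le hY' hY' hq₀))
    _ ≤ eLpNorm ED q₁ μ * ((C * eLpNorm (fun ω => squareFn fun n => g n ω) q₀ μ
          + C * eLpNorm (fun ω => squareFn fun n => g n ω) q₀ μ)
          + (C * eLpNorm (fun ω => squareFn fun n => g n ω) q₀ μ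
          + C * eLpNorm (fun ω => squareFn fun n => g n ω) q₀ μ)) := by
        gcongr
    _ = _ := by push_cast; ring

end Partition

/-! ### Deviations and variation -/

section DeviationVariation

/-- Repetitions in a nondecreasing sequence of times may be removed. -/
lemma sum_le_rVar₂ {r : ℝ≥0∞} (hr : r ≠ 0) (hr' : r ≠ ∞) {P : ℕ → ℕ → ℂ} (hP : ∀ s, P s s = 0)
    {v : ℕ → ℕ} (hv : Monotone v) (n : ℕ) :
    ∑ j ∈ Finset.range n, ‖P (v j) (v (j + 1))‖ₑ ^ r.toReal ≤ rVar₂ r P ^ r.toReal := by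
  have hpos := ENNReal.toReal_pos hr hr'
  suffices h : ∃ (J : ℕ) (u : Fin (J + 1) → ℕ), StrictMono u ∧ u (Fin.last J) = v n ∧
      ∑ j ∈ Finset.range n, ‖P (v j) (v (j + 1))‖ₑ ^ r.toReal
        ≤ ∑ j : Fin J, ‖P (u j.castSucc) (u j.succ)‖ₑ ^ r.toReal by
    obtain ⟨J, u, hu, -, hle⟩ := h
    refine hle.trans ?_
    rw [rVar₂, if_neg hr']
    have h1 := le_iSup_of_le J (le_iSup₂_of_le (f := fun (u : Fin (J + 1) → ℕ) (_ : StrictMono u) =>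
      (∑ j : Fin J, ‖P (u j.castSucc) (u j.succ)‖ₑ ^ r.toReal) ^ (1 / r.toReal)) u hu le_rfl)
      (f := fun J => ⨆ (u : Fin (J + 1) → ℕ) (_ : StrictMono u),
        (∑ j : Fin J, ‖P (u j.castSucc) (u j.succ)‖ₑ ^ r.toReal) ^ (1 / r.toReal))
    have h2 := ENNReal.rpow_le_rpow h1 hpos.le
    refine le_trans (le_of_eq ?_) h2
    rw [one_div, ENNReal.rpow_inv_rpow hpos.ne']
  induction n with
  | zero => exact ⟨0, fun _ => v 0, fun i j h => absurd h (by omega), rfl, by simp⟩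
  | succ n ih =>
    obtain ⟨J, u, hu, hlast, hle⟩ := ih
    rcases (hv (Nat.le_succ n)).eq_or_lt with h | h
    · refine ⟨J, u, hu, hlast.trans h, ?_⟩
      rw [Finset.sum_range_succ, ← Nat.succ_eq_add_one, ← h, hP, enorm_zero,
        ENNReal.zero_rpow_of_pos hpos, add_zero]
      exact hle
    · refine ⟨J + 1, Fin.snoc u (v (n + 1)), ?_, by simp, ?_⟩
      · rw [Fin.strictMono_iff_lt_succ]
        intro i
        refine Fin.lastCases ?_ (fun i => ?_) i
        · rw [Fin.succ_last, Fin.snoc_last, Fin.snoc_castSucc, hlast]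
          exact h
        · rw [Fin.snoc_castSucc, Fin.succ_castSucc, Fin.snoc_castSucc]
          exact hu Fin.castSucc_lt_succ
      · rw [Finset.sum_range_succ, Fin.sum_univ_castSucc, Fin.succ_last, Fin.snoc_last,
          Fin.snoc_castSucc, hlast]
        simp only [Fin.succ_castSucc, Fin.snoc_castSucc]
        gcongr

lemma sum_iSup_le_of_forall {c : ℕ → ℕ → ℝ≥0∞} {B : ℝ≥0∞} (s : Finset ℕ)
    (h : ∀ t : ℕ → ℕ, ∑ k ∈ s, c k (t k) ≤ B) : ∑ k ∈ s, ⨆ t, c k t ≤ B := by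
  classical
  suffices h' : ∀ x : ℝ≥0∞, (∀ t : ℕ → ℕ, x + ∑ k ∈ s, c k (t k) ≤ B) →
      x + ∑ k ∈ s, ⨆ t, c k t ≤ B by
    simpa using h' 0 (by simpa using h)
  clear h
  induction s using Finset.induction_on with
  | empty => intro x h; simpa using h 0
  | insert a s ha ih =>
    intro x h
    rw [Finset.sum_insert ha, ← add_assoc, ENNReal.add_iSup, ENNReal.iSup_add]
    refine iSup_le fun n => ih _ fun t => ?_
    have h1 := h (Function.update t a n)
    rw [Finset.sum_insert ha, Function.update_self, ← add_assoc] at h1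
    refine le_trans (le_of_eq ?_) h1
    congr 1
    refine Finset.sum_congr rfl fun k hk => ?_
    rw [Function.update_of_ne (ne_of_mem_of_not_mem hk ha)]

/-- The deviations over the intervals of a partition are controlled by the variation. -/
lemma ellNorm_deviation_le_rVar {Ω : Type*} {r : ℝ≥0∞} (hr : r ≠ 0) (f : ℕ → Ω → ℂ)
    {τ : ℕ → Ω → WithTop ℕ} {ω : Ω} (hτ : Monotone fun k => τ k ω) :
    ellNorm r (fun k => deviation f τ k ω) ≤ rVar r fun n => f n ω := by
  classical
  rw [ellNorm]
  split_ifs with hr'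
  · subst hr'
    rw [rVar, rVar₂, if_pos rfl]
    refine iSup_le fun k => iSup₂_le fun t ht => ?_
    obtain ⟨a, ha⟩ := WithTop.ne_top_iff_exists.1 (ne_top_of_le_ne_top (WithTop.coe_ne_top) ht.1)
    rw [stoppedValue, ← ha, untopA_some]
    have hat : a ≤ t := by
      have := ht.1
      rw [← ha] at this
      exact WithTop.coe_le_coe.1 this
    rcases hat.eq_or_lt with rfl | hat
    · simp
    · exact le_iSup_of_le a (le_iSup₂_of_le (f := fun (t : ℕ) (_ : a < t) =>
        ‖delta (fun n => f n ω) a t‖ₑ) t hat le_rfl)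
  have hpos := ENNReal.toReal_pos hr hr'
  rw [one_div, ENNReal.rpow_inv_le_iff hpos]
  refine ENNReal.tsum_le_of_sum_range_le fun K => ?_
  let c : ℕ → ℕ → ℝ≥0∞ := fun k t =>
    if τ k ω ≤ t ∧ (t : WithTop ℕ) < τ (k + 1) ω then
      ‖f t ω - stoppedValue f (τ k) ω‖ₑ ^ r.toReal else 0
  have hc : ∀ k, deviation f τ k ω ^ r.toReal = ⨆ t, c k t := by
    intro k
    rw [deviation]
    have h1 := (ENNReal.orderIsoRpow r.toReal hpos).map_iSup (fun t : ℕ =>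
      ⨆ (_ : τ k ω ≤ t ∧ t < τ (k + 1) ω), ‖f t ω - stoppedValue f (τ k) ω‖ₑ)
    simp only [ENNReal.orderIsoRpow_apply] at h1
    rw [h1]
    refine iSup_congr fun t => ?_
    simp only [c]
    split_ifs with h
    · simp [h]
    · simp [h, ENNReal.zero_rpow_of_pos hpos]
  simp only [hc]
  refine sum_iSup_le_of_forall _ fun t => ?_
  -- interlace the left endpoints, cut off at a large time `L`, with the chosen times
  let L := (Finset.range K).sup t
  let a : ℕ → ℕ := fun k => (min (τ k ω) (WithTop.some L)).untopA
  have ha : ∀ k, WithTop.some (a k) = min (τ k ω) (WithTop.some L) := fun k => by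
    obtain ⟨b, hb⟩ := WithTop.ne_top_iff_exists.1
      (ne_top_of_le_ne_top WithTop.coe_ne_top (min_le_right (τ k ω) (WithTop.some L)))
    simp only [a]
    rw [← hb, untopA_some]
  let act : ℕ → Prop := fun k => τ k ω ≤ t k ∧ (t k : WithTop ℕ) < τ (k + 1) ω ∧ t k ≤ L
  let b : ℕ → ℕ := fun k => if act k then t k else a k
  have hab : ∀ k, a k ≤ b k := fun k => by
    simp only [b]
    split_ifs with h
    · rw [← WithTop.coe_le_coe, ha]
      exact (min_le_left _ _).trans h.1
    · exact le_rfl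
  have hba : ∀ k, b k ≤ a (k + 1) := fun k => by
    rw [← WithTop.coe_le_coe, ha]
    simp only [b]
    split_ifs with h
    · exact le_min h.2.1.le (WithTop.coe_le_coe.2 h.2.2)
    · rw [ha]
      exact min_le_min_right _ (hτ (Nat.le_succ k))
  let v : ℕ → ℕ := fun n => if Even n then a (n / 2) else b (n / 2)
  have hv0 : ∀ k, v (2 * k) = a k := fun k => by simp [v]
  have hv1 : ∀ k, v (2 * k + 1) = b k := fun k => by
    have h : (2 * k + 1) / 2 = k := by omega
    simp [v, h]
  have hv : Monotone v := monotone_nat_of_le_succ fun n => by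
    obtain ⟨k, rfl | rfl⟩ := Nat.even_or_odd' n
    · rw [hv0, hv1]; exact hab k
    · rw [hv1, show 2 * k + 1 + 1 = 2 * (k + 1) by ring, hv0]; exact hba k
  have hsum := sum_le_rVar₂ hr hr' (P := delta fun n => f n ω) (by simp [delta]) hv (2 * K)
  refine le_trans ?_ hsum
  have hdouble : ∀ (G : ℕ → ℝ≥0∞) (n : ℕ), ∑ k ∈ Finset.range n, G (2 * k)
      ≤ ∑ j ∈ Finset.range (2 * n), G j := fun G n => by
    induction n with
    | zero => simp
    | succ n ih =>
      rw [show 2 * (n + 1) = 2 * n + 1 + 1 by ring, Finset.sum_range_succ, Finset.sum_range_succ,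
        Finset.sum_range_succ]
      exact (add_le_add ih le_rfl).trans le_self_add
  refine le_trans (Finset.sum_le_sum fun k hk => ?_) (hdouble _ K)
  rw [hv0, hv1]
  simp only [c]
  split_ifs with h
  · have htL : t k ≤ L := Finset.le_sup (f := t) hk
    have hτk : τ k ω = WithTop.some (a k) := by
      rw [ha, min_eq_left (h.1.trans (WithTop.coe_le_coe.2 htL))]
    have hb : b k = t k := if_pos ⟨h.1, h.2, htL⟩
    rw [hb, stoppedValue, hτk, untopA_some, delta]
  · exact zero_le

end DeviationVariation

/-! ### Threshold partitions -/

section Threshold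

/-- The largest `‖P s t‖` with `s` and `t` in `[a, b]`. No order of `s` and `t` is imposed, as `P s t`
vanishes for `t ≤ s` in the case of interest. -/
noncomputable def intMax (P : ℕ → ℕ → ℂ) (a b : ℕ) : ℝ≥0 :=
  (Finset.Icc a b ×ˢ Finset.Icc a b).sup fun i => ‖P i.1 i.2‖₊

lemma nnnorm_le_intMax (P : ℕ → ℕ → ℂ) {a b s t : ℕ} (h1 : a ≤ s) (h2 : s ≤ t) (h3 : t ≤ b) :
    ‖P s t‖₊ ≤ intMax P a b :=
  Finset.le_sup (f := fun i : ℕ × ℕ => ‖P i.1 i.2‖₊) (b := (s, t))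
    (Finset.mem_product.2 ⟨Finset.mem_Icc.2 ⟨h1, h2.trans h3⟩,
      Finset.mem_Icc.2 ⟨h1.trans h2, h3⟩⟩)

lemma intMax_mono (P : ℕ → ℕ → ℂ) (a : ℕ) : Monotone (intMax P a) := fun _ _ h =>
  Finset.sup_mono (Finset.product_subset_product (Finset.Icc_subset_Icc_right h)
    (Finset.Icc_subset_Icc_right h))

open Classical in
/-- The first time `b > T` such that some `‖P s t‖` with `T ≤ s`, `t ≤ b` exceeds `θ` times the
running maximum of `‖P‖` at time `b`. -/
noncomputable def nextTime (θ : ℝ≥0) (P : ℕ → ℕ → ℂ) (T : WithTop ℕ) : WithTop ℕ :=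
  if {b : ℕ | ∃ a : ℕ, T = a ∧ a < b ∧ θ * intMax P 0 b < intMax P a b}.Nonempty then
    WithTop.some (sInf {b : ℕ | ∃ a : ℕ, T = a ∧ a < b ∧ θ * intMax P 0 b < intMax P a b})
  else ⊤

/-- The partition obtained by iterating `nextTime`. -/
noncomputable def thresholdTime (θ : ℝ≥0) (P : ℕ → ℕ → ℂ) : ℕ → WithTop ℕ
  | 0 => 0
  | k + 1 => nextTime θ P (thresholdTime θ P k)

variable {θ : ℝ≥0} {P : ℕ → ℕ → ℂ}

lemma exists_of_nextTime_eq {T : WithTop ℕ} {b : ℕ} (h : nextTime θ P T = b) :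
    ∃ a : ℕ, T = a ∧ a < b ∧ θ * intMax P 0 b < intMax P a b := by
  rw [nextTime] at h
  split_ifs at h with hne
  · have h1 := Nat.sInf_mem hne
    have h2 : sInf {b : ℕ | ∃ a : ℕ, T = a ∧ a < b ∧ θ * intMax P 0 b < intMax P a b} = b :=
      WithTop.coe_injective h
    rwa [h2] at h1
  · exact absurd h WithTop.top_ne_coe

lemma nextTime_le {a b : ℕ} (hab : a < b) (h : θ * intMax P 0 b < intMax P a b) :
    nextTime θ P a ≤ b := by
  have hb : b ∈ {b : ℕ | ∃ a' : ℕ, (a : WithTop ℕ) = a' ∧ a' < b ∧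
      θ * intMax P 0 b < intMax P a' b} := ⟨a, rfl, hab, h⟩
  rw [nextTime, if_pos ⟨b, hb⟩]
  exact WithTop.coe_le_coe.2 (Nat.sInf_le hb)

lemma exists_coe_of_le {T : WithTop ℕ} {n : ℕ} (h : T ≤ n) : ∃ a : ℕ, T = a ∧ a ≤ n := by
  obtain ⟨a, rfl⟩ := WithTop.ne_top_iff_exists.1 (ne_top_of_le_ne_top WithTop.coe_ne_top h)
  exact ⟨a, rfl, WithTop.coe_le_coe.1 h⟩

lemma nextTime_le_iff {T : WithTop ℕ} {n : ℕ} : nextTime θ P T ≤ n ↔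
    ∃ b ≤ n, ∃ a < b, T = (a : ℕ) ∧ θ * intMax P 0 b < intMax P a b := by
  constructor
  · intro h
    obtain ⟨b, hb, hbn⟩ := exists_coe_of_le h
    obtain ⟨a, h1, h2, h3⟩ := exists_of_nextTime_eq hb
    exact ⟨b, hbn, a, h2, h1, h3⟩
  · rintro ⟨b, hbn, a, hab, rfl, h⟩
    exact (nextTime_le hab h).trans (WithTop.coe_le_coe.2 hbn)

lemma le_nextTime (T : WithTop ℕ) : T ≤ nextTime θ P T := by
  rcases eq_or_ne (nextTime θ P T) ⊤ with h | h
  · rw [h]; exact le_top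
  · obtain ⟨b, hb⟩ := WithTop.ne_top_iff_exists.1 h
    obtain ⟨a, h1, h2, -⟩ := exists_of_nextTime_eq hb.symm
    rw [← hb, h1]
    exact WithTop.coe_le_coe.2 h2.le

lemma thresholdTime_mono : Monotone (thresholdTime θ P) :=
  monotone_nat_of_le_succ fun _ => le_nextTime _

lemma natCast_le_thresholdTime (k : ℕ) : (k : WithTop ℕ) ≤ thresholdTime θ P k := by
  induction k with
  | zero => exact le_rfl
  | succ k ih =>
    rcases eq_or_ne (thresholdTime θ P (k + 1)) ⊤ with h | h
    · rw [h]; exact le_top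
    · obtain ⟨b, hb⟩ := WithTop.ne_top_iff_exists.1 h
      obtain ⟨a, h1, h2, -⟩ := exists_of_nextTime_eq (hb.symm : nextTime θ P _ = b)
      rw [← hb]
      rw [h1] at ih
      have : k ≤ a := WithTop.coe_le_coe.1 ih
      exact WithTop.coe_le_coe.2 (show k + 1 ≤ b by omega)

/-- An interval over which `P` is large contains a threshold time. -/
lemma exists_thresholdTime_mem {s t : ℕ} (hst : s < t) (h : θ * intMax P 0 t < ‖P s t‖₊) :
    ∃ k a b : ℕ, thresholdTime θ P k = a ∧ thresholdTime θ P (k + 1) = b ∧ s < b ∧ b ≤ t ∧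
      θ * intMax P 0 b < intMax P a b := by
  classical
  have hex : ∃ k, (s : WithTop ℕ) < thresholdTime θ P (k + 1) :=
    ⟨s, (WithTop.coe_lt_coe.2 (Nat.lt_succ_self s)).trans_le (natCast_le_thresholdTime (s + 1))⟩
  have hk := Nat.find_spec hex
  set k := Nat.find hex with hk_def
  have hks : thresholdTime θ P k ≤ s := by
    rcases Nat.eq_zero_or_pos k with h0 | h0
    · rw [h0]; exact WithTop.coe_le_coe.2 (Nat.zero_le s)
    · have := Nat.find_min hex (m := k - 1) (by omega)
      rw [Nat.sub_add_cancel h0] at this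
      exact not_lt.1 this
  obtain ⟨a, ha, has⟩ := exists_coe_of_le hks
  have hle : thresholdTime θ P (k + 1) ≤ t := by
    change nextTime θ P (thresholdTime θ P k) ≤ t
    rw [ha]
    exact nextTime_le (has.trans_lt hst) (h.trans_le (nnnorm_le_intMax P has hst.le le_rfl))
  obtain ⟨b, hb, hbt⟩ := exists_coe_of_le hle
  obtain ⟨a', h1, -, h3⟩ := exists_of_nextTime_eq (hb : nextTime θ P _ = b)
  have : a' = a := WithTop.coe_injective (h1.symm.trans ha)
  subst this
  refine ⟨k, a', b, ha, hb, ?_, hbt, h3⟩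
  rw [hb] at hk
  exact WithTop.coe_lt_coe.1 hk

/-- The largest `‖P s t‖` over subintervals of the `k`-th interval of a partition. -/
noncomputable def blockMax (P : ℕ → ℕ → ℂ) (T : ℕ → WithTop ℕ) (k : ℕ) : ℝ≥0∞ :=
  ⨆ (s : ℕ) (t : ℕ) (_ : T k ≤ s ∧ s ≤ t ∧ t ≤ T (k + 1)), ‖P s t‖ₑ

lemma intMax_le_blockMax (hP : ∀ s t, t ≤ s → P s t = 0) {T : ℕ → WithTop ℕ} {k a b : ℕ}
    (ha : T k = a) (hb : T (k + 1) = b) : (intMax P a b : ℝ≥0∞) ≤ blockMax P T k := by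
  obtain h | h := (Finset.Icc a b ×ˢ Finset.Icc a b).eq_empty_or_nonempty
  · rw [intMax, h]; simp
  obtain ⟨⟨s, t⟩, hi, he⟩ := Finset.exists_mem_eq_sup _ h fun i : ℕ × ℕ => ‖P i.1 i.2‖₊
  rw [intMax, he]
  rw [Finset.mem_product, Finset.mem_Icc, Finset.mem_Icc] at hi
  rcases le_total t s with hts | hst
  · simp [hP s t hts]
  · refine le_iSup_of_le s (le_iSup₂_of_le (f := fun (t : ℕ)
      (_ : T k ≤ s ∧ s ≤ t ∧ t ≤ T (k + 1)) => ‖P s t‖ₑ) t ⟨?_, hst, ?_⟩ le_rfl)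
    · rw [ha]; exact WithTop.coe_le_coe.2 hi.1.1
    · rw [hb]; exact WithTop.coe_le_coe.2 hi.2.2

/-- Terms of the variation sum which are comparable to `θ` times the running maximum, where the
running maximum at most doubles. Different terms meet different intervals of the partition. -/
lemma sum_rpow_le_tsum_blockMax (hP : ∀ s t, t ≤ s → P s t = 0) {ρ : ℝ} (hρ : 0 < ρ)
    {v : ℕ → ℕ} (hv : Monotone v) (G : Finset ℕ) (hlt : ∀ j ∈ G, v j < v (j + 1))
    (h1 : ∀ j ∈ G, θ * intMax P 0 (v (j + 1)) < ‖P (v j) (v (j + 1))‖₊)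
    (h2 : ∀ j ∈ G, ‖P (v j) (v (j + 1))‖₊ ≤ 2 * θ * intMax P 0 (v (j + 1)))
    (h3 : ∀ j ∈ G, intMax P 0 (v (j + 1)) ≤ 2 * intMax P 0 (v j)) :
    ∑ j ∈ G, ‖P (v j) (v (j + 1))‖ₑ ^ ρ
      ≤ 4 ^ ρ * ∑' k, blockMax P (thresholdTime θ P) k ^ ρ := by
  classical
  have hex : ∀ j, ∃ k, j ∈ G → ∃ a b : ℕ, thresholdTime θ P k = a ∧
      thresholdTime θ P (k + 1) = b ∧ v j < b ∧ b ≤ v (j + 1) ∧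
      θ * intMax P 0 b < intMax P a b := fun j => by
    by_cases hj : j ∈ G
    · obtain ⟨k, a, b, h⟩ := exists_thresholdTime_mem (hlt j hj) (h1 j hj)
      exact ⟨k, fun _ => ⟨a, b, h⟩⟩
    · exact ⟨0, fun h => absurd h hj⟩
  choose κ hκ using hex
  have hinj : Set.InjOn κ G := by
    intro i hi j hj hij
    obtain ⟨a, b, -, hb, hb1, hb2, -⟩ := hκ i hi
    obtain ⟨a', b', -, hb', hb1', hb2', -⟩ := hκ j hj
    rw [hij, hb'] at hb
    have : b' = b := WithTop.coe_injective hb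
    subst this
    by_contra hne
    rcases lt_or_gt_of_ne hne with h | h
    · have := hv (Nat.succ_le_of_lt h); change v (i + 1) ≤ v j at this; omega
    · have := hv (Nat.succ_le_of_lt h); change v (j + 1) ≤ v i at this; omega
  have hterm : ∀ j ∈ G, ‖P (v j) (v (j + 1))‖ₑ ^ ρ
      ≤ 4 ^ ρ * blockMax P (thresholdTime θ P) (κ j) ^ ρ := by
    intro j hj
    obtain ⟨a, b, ha, hb, hb1, hb2, h4⟩ := hκ j hj
    rw [← ENNReal.mul_rpow_of_nonneg _ _ hρ.le]
    refine ENNReal.rpow_le_rpow ?_ hρ.le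
    have h5 : ‖P (v j) (v (j + 1))‖₊ ≤ 4 * intMax P a b := by
      calc _ ≤ 2 * θ * intMax P 0 (v (j + 1)) := h2 j hj
        _ ≤ 2 * θ * (2 * intMax P 0 (v j)) := by gcongr; exact h3 j hj
        _ = 4 * (θ * intMax P 0 (v j)) := by ring
        _ ≤ 4 * (θ * intMax P 0 b) := by gcongr; exact intMax_mono P 0 hb1.le
        _ ≤ 4 * intMax P a b := by gcongr
    calc ‖P (v j) (v (j + 1))‖ₑ ≤ ((4 * intMax P a b : ℝ≥0) : ℝ≥0∞) := by
          exact ENNReal.coe_le_coe.2 h5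
      _ = 4 * (intMax P a b : ℝ≥0∞) := by push_cast; rfl
      _ ≤ _ := by gcongr; exact intMax_le_blockMax hP ha hb
  calc ∑ j ∈ G, ‖P (v j) (v (j + 1))‖ₑ ^ ρ
      ≤ ∑ j ∈ G, 4 ^ ρ * blockMax P (thresholdTime θ P) (κ j) ^ ρ := Finset.sum_le_sum hterm
    _ = 4 ^ ρ * ∑ j ∈ G, blockMax P (thresholdTime θ P) (κ j) ^ ρ := by rw [Finset.mul_sum]
    _ = 4 ^ ρ * ∑ k ∈ G.image κ, blockMax P (thresholdTime θ P) k ^ ρ := by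
        rw [Finset.sum_image hinj]
    _ ≤ _ := by gcongr; exact ENNReal.sum_le_tsum _

/-- The values right after a doubling of a nondecreasing sequence grow geometrically. -/
lemma sum_doubling_le {r : ℝ} (hr : 0 < r) {w : ℕ → ℝ} (hw : Monotone w) (hw0 : ∀ n, 0 ≤ w n)
    (n : ℕ) : ∑ j ∈ Finset.range n, (if 2 * w j < w (j + 1) then w (j + 1) ^ r else 0)
      ≤ (1 - 2 ^ (-r))⁻¹ * w n ^ r := by
  have hlt : (2 : ℝ) ^ (-r) < 1 := Real.rpow_lt_one_of_one_lt_of_neg (by norm_num) (by linarith)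
  have hC : 0 < (1 - (2 : ℝ) ^ (-r))⁻¹ := inv_pos.2 (by linarith)
  have hCe : (1 - (2 : ℝ) ^ (-r))⁻¹ * 2 ^ (-r) + 1 = (1 - (2 : ℝ) ^ (-r))⁻¹ := by
    have : 1 - (2 : ℝ) ^ (-r) ≠ 0 := by linarith
    field_simp
    ring
  induction n with
  | zero => simpa using mul_nonneg hC.le (Real.rpow_nonneg (hw0 0) r)
  | succ n ih =>
    rw [Finset.sum_range_succ]
    split_ifs with h
    · have h1 : w n ^ r ≤ 2 ^ (-r) * w (n + 1) ^ r := by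
        have : (2 : ℝ) ^ (-r) * w (n + 1) ^ r = (w (n + 1) / 2) ^ r := by
          rw [Real.div_rpow (hw0 _) (by norm_num), Real.rpow_neg (by norm_num)]
          ring
        rw [this]
        exact Real.rpow_le_rpow (hw0 n) (by linarith) hr.le
      calc _ ≤ (1 - 2 ^ (-r))⁻¹ * (2 ^ (-r) * w (n + 1) ^ r) + w (n + 1) ^ r := by
            gcongr
            exact ih.trans (by gcongr)
        _ = ((1 - 2 ^ (-r))⁻¹ * 2 ^ (-r) + 1) * w (n + 1) ^ r := by ring
        _ = _ := by rw [hCe]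
    · rw [add_zero]
      refine ih.trans ?_
      have := Real.rpow_le_rpow (hw0 n) (hw (Nat.le_succ n)) hr.le
      exact mul_le_mul_of_nonneg_left this hC.le

/-- The pathwise bound for the `r`-variation of a function of two time variables by its `ℓ^ρ` norms,
`ρ < r`, over the partitions at thresholds `2^{-m-1}` relative to the running maximum. -/
theorem sum_rpow_le_threshold (hP : ∀ s t, t ≤ s → P s t = 0) {ρ r : ℝ} (hρ : 0 < ρ) (hr : ρ < r)
    {W : ℝ≥0∞} (hW : ∀ s t, ‖P s t‖ₑ ≤ W) {J : ℕ} {u : Fin (J + 1) → ℕ} (hu : StrictMono u) :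
    ∑ j : Fin J, ‖P (u j.castSucc) (u j.succ)‖ₑ ^ r
      ≤ ENNReal.ofReal (1 - 2 ^ (-r))⁻¹ * W ^ r + ∑' m : ℕ, ((2⁻¹ ^ m) * W) ^ (r - ρ)
        * (4 ^ ρ * ∑' k, blockMax P (thresholdTime (2⁻¹ ^ (m + 1)) P) k ^ ρ) := by
  classical
  have hr0 : 0 < r := hρ.trans hr
  let v : ℕ → ℕ := fun n => u ⟨min n J, by omega⟩
  have hv : Monotone v := fun i j h => hu.monotone (by
    simp only [Fin.mk_le_mk]; omega)
  have hvlt : ∀ j < J, v j < v (j + 1) := fun j hj => hu (by simp only [Fin.mk_lt_mk]; omega)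
  have e1 : ∑ j : Fin J, ‖P (u j.castSucc) (u j.succ)‖ₑ ^ r
      = ∑ j ∈ Finset.range J, ‖P (v j) (v (j + 1))‖ₑ ^ r := by
    rw [← Fin.sum_univ_eq_sum_range (fun j => ‖P (v j) (v (j + 1))‖ₑ ^ r) J]
    refine Finset.sum_congr rfl fun j _ => ?_
    have h1 : v j = u j.castSucc := congrArg u (Fin.ext (min_eq_left j.2.le))
    have h2 : v (j + 1) = u j.succ := congrArg u (Fin.ext (min_eq_left j.2))
    rw [h1, h2]
  rw [e1]
  let M : ℕ → ℝ≥0 := fun n => intMax P 0 (v n)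
  have hM : Monotone M := fun i j h => intMax_mono P 0 (hv h)
  have hPM : ∀ j < J, ‖P (v j) (v (j + 1))‖₊ ≤ M (j + 1) := fun j hj =>
    nnnorm_le_intMax P (Nat.zero_le _) (hvlt j hj).le le_rfl
  have hMW : ∀ n, (M n : ℝ≥0∞) ≤ W := fun n => by
    obtain ⟨⟨s, t⟩, -, he⟩ := Finset.exists_mem_eq_sup (Finset.Icc 0 (v n) ×ˢ Finset.Icc 0 (v n))
      ⟨(0, 0), by simp⟩ fun i : ℕ × ℕ => ‖P i.1 i.2‖₊
    change ((intMax P 0 (v n) : ℝ≥0) : ℝ≥0∞) ≤ W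
    rw [intMax, he]
    exact hW s t
  let G : ℕ → Finset ℕ := fun m => (Finset.range J).filter fun j =>
    2⁻¹ ^ (m + 1) * M (j + 1) < ‖P (v j) (v (j + 1))‖₊ ∧
    ‖P (v j) (v (j + 1))‖₊ ≤ 2⁻¹ ^ m * M (j + 1) ∧ M (j + 1) ≤ 2 * M j
  have hterm : ∀ j ∈ Finset.range J, ‖P (v j) (v (j + 1))‖ₑ ^ r
      ≤ (if 2 * M j < M (j + 1) then ((M (j + 1) ^ r : ℝ≥0) : ℝ≥0∞) else 0)
        + ∑' m : ℕ, if j ∈ G m then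
          ((2⁻¹ ^ m) * W) ^ (r - ρ) * ‖P (v j) (v (j + 1))‖ₑ ^ ρ else 0 := by
    intro j hj
    have hjJ := Finset.mem_range.1 hj
    by_cases hE : 2 * M j < M (j + 1)
    · rw [if_pos hE]
      refine le_trans ?_ le_self_add
      rw [ENNReal.coe_rpow_of_nonneg _ hr0.le]
      exact ENNReal.rpow_le_rpow (ENNReal.coe_le_coe.2 (hPM j hjJ)) hr0.le
    rw [if_neg hE, zero_add]
    rcases eq_or_ne ‖P (v j) (v (j + 1))‖₊ 0 with h0 | h0
    · have : ‖P (v j) (v (j + 1))‖ₑ = 0 := by simpa using h0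
      rw [this, ENNReal.zero_rpow_of_pos hr0]
      exact zero_le
    have hpos : 0 < ‖P (v j) (v (j + 1))‖₊ := pos_iff_ne_zero.2 h0
    have hMpos : 0 < M (j + 1) := hpos.trans_le (hPM j hjJ)
    obtain ⟨m, hm1, hm2⟩ := exists_nat_pow_near_of_lt_one
      (x := ((‖P (v j) (v (j + 1))‖₊ / M (j + 1) : ℝ≥0) : ℝ)) (y := 2⁻¹)
      (by exact_mod_cast div_pos hpos hMpos)
      (by exact_mod_cast div_le_one_of_le₀ (hPM j hjJ) hMpos.le) (by norm_num) (by norm_num)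
    have hm1' : 2⁻¹ ^ (m + 1) < ‖P (v j) (v (j + 1))‖₊ / M (j + 1) := by
      rw [← NNReal.coe_lt_coe]; push_cast; simpa using hm1
    have hm2' : ‖P (v j) (v (j + 1))‖₊ / M (j + 1) ≤ 2⁻¹ ^ m := by
      rw [← NNReal.coe_le_coe]; push_cast; simpa using hm2
    rw [lt_div_iff₀ hMpos] at hm1'
    rw [div_le_iff₀ hMpos] at hm2'
    have hjG : j ∈ G m := Finset.mem_filter.2 ⟨hj, hm1', hm2', not_lt.1 hE⟩
    refine le_trans ?_ (ENNReal.le_tsum m)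
    rw [if_pos hjG]
    have h1 : ‖P (v j) (v (j + 1))‖ₑ ≤ 2⁻¹ ^ m * W := by
      calc ‖P (v j) (v (j + 1))‖ₑ ≤ ((2⁻¹ ^ m * M (j + 1) : ℝ≥0) : ℝ≥0∞) :=
            ENNReal.coe_le_coe.2 hm2'
        _ = 2⁻¹ ^ m * (M (j + 1) : ℝ≥0∞) := by
            rw [ENNReal.coe_mul, ENNReal.coe_pow, ENNReal.coe_inv (by norm_num)]; rfl
        _ ≤ _ := by gcongr; exact hMW _
    calc ‖P (v j) (v (j + 1))‖ₑ ^ r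
        = ‖P (v j) (v (j + 1))‖ₑ ^ (r - ρ) * ‖P (v j) (v (j + 1))‖ₑ ^ ρ := by
          rw [← ENNReal.rpow_add_of_nonneg _ _ (by linarith) hρ.le, sub_add_cancel]
      _ ≤ _ := by
          gcongr
  refine (Finset.sum_le_sum hterm).trans ?_
  rw [Finset.sum_add_distrib]
  refine add_le_add ?_ ?_
  · have h1 := sum_doubling_le hr0 (w := fun n => (M n : ℝ)) (fun i j h => hM h)
      (fun n => (M n).2) J
    have h2 : ∑ j ∈ Finset.range J, (if 2 * M j < M (j + 1) then
        ((M (j + 1) ^ r : ℝ≥0) : ℝ≥0∞) else 0)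
        = ENNReal.ofReal (∑ j ∈ Finset.range J,
          (if 2 * (M j : ℝ) < M (j + 1) then (M (j + 1) : ℝ) ^ r else 0)) := by
      rw [ENNReal.ofReal_sum_of_nonneg fun j _ => by split_ifs <;> positivity]
      refine Finset.sum_congr rfl fun j _ => ?_
      have : (2 * M j < M (j + 1)) ↔ (2 * (M j : ℝ) < M (j + 1)) := by
        rw [← NNReal.coe_lt_coe]; push_cast; rfl
      simp only [this]
      split_ifs
      · rw [← NNReal.coe_rpow, ENNReal.ofReal_coe_nnreal]
      · simp
    rw [h2]
    have hC : 0 ≤ (1 - (2 : ℝ) ^ (-r))⁻¹ := inv_nonneg.2 (by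
      have : (2 : ℝ) ^ (-r) < 1 :=
        Real.rpow_lt_one_of_one_lt_of_neg (by norm_num) (by linarith)
      linarith)
    refine (ENNReal.ofReal_le_ofReal h1).trans ?_
    rw [ENNReal.ofReal_mul hC, ← NNReal.coe_rpow, ENNReal.ofReal_coe_nnreal,
      ENNReal.coe_rpow_of_nonneg _ hr0.le]
    gcongr
    exact hMW J
  · rw [← Summable.tsum_finsetSum fun _ _ => ENNReal.summable]
    refine ENNReal.tsum_le_tsum fun m => ?_
    have hG : G m ⊆ Finset.range J := Finset.filter_subset _ _
    rw [← Finset.sum_filter, Finset.filter_mem_eq_inter, Finset.inter_eq_right.2 hG,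
      ← Finset.mul_sum]
    refine mul_le_mul' le_rfl ?_
    have hmem : ∀ j ∈ G m, j < J ∧ 2⁻¹ ^ (m + 1) * M (j + 1) < ‖P (v j) (v (j + 1))‖₊ ∧
        ‖P (v j) (v (j + 1))‖₊ ≤ 2⁻¹ ^ m * M (j + 1) ∧ M (j + 1) ≤ 2 * M j := fun j hj => by
      have := Finset.mem_filter.1 hj
      exact ⟨Finset.mem_range.1 this.1, this.2⟩
    refine sum_rpow_le_tsum_blockMax hP hρ hv (G m) (fun j hj => hvlt j (hmem j hj).1)
      (fun j hj => (hmem j hj).2.1) (fun j hj => ?_) (fun j hj => (hmem j hj).2.2.2)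
    have : 2 * (2⁻¹ : ℝ≥0) ^ (m + 1) = 2⁻¹ ^ m := by
      rw [pow_succ]; field_simp
    rw [this]
    exact (hmem j hj).2.2.1

end Threshold

/-! ### Integration of the pathwise variation bound -/

section Variation

variable {Ω : Type*} {m : MeasurableSpace Ω} {ℱ : Filtration ℕ m}

lemma measurable_finset_sup_nnnorm {ι : Type*} {F : ι → Ω → ℂ} (s : Finset ι)
    (hF : ∀ i ∈ s, Measurable (F i)) : Measurable fun ω => s.sup fun i => ‖F i ω‖₊ := by
  classical
  induction s using Finset.induction_on with
  | empty => simp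
  | insert a s ha ih =>
    simp only [Finset.sup_insert]
    exact (hF a (Finset.mem_insert_self a s)).nnnorm.sup
      (ih fun i hi => hF i (Finset.mem_insert_of_mem hi))

lemma measurable_intMax {P : Ω → ℕ → ℕ → ℂ}
    (hP : ∀ s t n, t ≤ n → Measurable[ℱ n] fun ω => P ω s t) (a b : ℕ) :
    Measurable[ℱ b] fun ω => intMax (P ω) a b :=
  measurable_finset_sup_nnnorm (F := fun (i : ℕ × ℕ) ω => P ω i.1 i.2) _ fun _ hi =>
    hP _ _ _ (Finset.mem_Icc.1 (Finset.mem_product.1 hi).2).2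

/-- The threshold times of an adapted process of two time variables are stopping times. -/
lemma isAdaptedPartition_thresholdTime {P : Ω → ℕ → ℕ → ℂ}
    (hP : ∀ s t n, t ≤ n → Measurable[ℱ n] fun ω => P ω s t) (θ : ℝ≥0) :
    IsAdaptedPartition ℱ fun k ω => thresholdTime θ (P ω) k where
  isStoppingTime k := by
    induction k with
    | zero => exact isStoppingTime_const ℱ 0
    | succ k ih =>
      intro n
      have e : {ω | thresholdTime θ (P ω) (k + 1) ≤ n}
          = ⋃ b ∈ Set.Iic n, ⋃ a ∈ Set.Iio b, {ω | thresholdTime θ (P ω) k = (a : ℕ)}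
            ∩ {ω | θ * intMax (P ω) 0 b < intMax (P ω) a b} := by
        ext ω
        simp only [Set.mem_ofPred_eq, Set.mem_iUnion, Set.mem_Iic, Set.mem_Iio, Set.mem_inter_iff,
          exists_prop]
        exact nextTime_le_iff
      change MeasurableSet[ℱ n] {ω | thresholdTime θ (P ω) (k + 1) ≤ n}
      rw [e]
      refine MeasurableSet.biUnion (Set.to_countable _) fun b hb =>
        MeasurableSet.biUnion (Set.to_countable _) fun a ha => ?_
      refine ℱ.mono hb _ (MeasurableSet.inter ?_ ?_)
      · exact ℱ.mono (le_of_lt ha) _ (ih.measurableSet_eq a)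
      · exact measurableSet_lt ((measurable_intMax hP 0 b).const_mul θ) (measurable_intMax hP a b)
  zero _ := rfl
  mono _ := thresholdTime_mono

/-- The partition with the single nonempty interval `[0, ∞)`. -/
def trivialPartition (Ω : Type*) : ℕ → Ω → WithTop ℕ
  | 0, _ => 0
  | _ + 1, _ => ⊤

lemma isAdaptedPartition_trivialPartition : IsAdaptedPartition ℱ (trivialPartition Ω) where
  isStoppingTime k := by
    cases k with
    | zero => exact isStoppingTime_const ℱ 0
    | succ k => intro n; simp [trivialPartition]
  zero _ := rfl
  mono ω := monotone_nat_of_le_succ fun k => by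
    simp [trivialPartition]

lemma le_ellNorm {r : ℝ≥0∞} (hr : r ≠ 0) (a : ℕ → ℝ≥0∞) (k : ℕ) : a k ≤ ellNorm r a := by
  rw [ellNorm]
  split_ifs with h
  · exact le_iSup a k
  · rw [one_div, ENNReal.le_rpow_inv_iff (ENNReal.toReal_pos hr h)]
    exact ENNReal.le_tsum k

lemma enorm_paraproduct_le_trivialPartition (f g : ℕ → Ω → ℂ) (ω : Ω) (s t : ℕ) :
    ‖paraproduct (delta fun n => f n ω) (fun n => g n ω) s t‖ₑ
      ≤ paraproductMax f g (trivialPartition Ω) 0 ω := by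
  rcases le_total t s with h | h
  · simp [paraproduct_of_le _ _ h]
  · exact le_iSup_of_le s (le_iSup₂_of_le (f := fun (t : ℕ) (_ : trivialPartition Ω 0 ω ≤ s ∧ s ≤ t ∧
      t ≤ trivialPartition Ω 1 ω) =>
        ‖paraproduct (delta fun n => f n ω) (fun n => g n ω) s t‖ₑ) t
        ⟨WithTop.coe_le_coe.2 (Nat.zero_le s), h, le_top⟩ le_rfl)

/-- Summation of the pathwise bound: `Z ^ (1 / q)` dominates the weighted `ℓ^q` sum of
the `B m`, so that it dominates each of them up to a factor growing more slowly than `2^{m(r-ρ)}`. -/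
lemma threshold_sum_le {ρ r q : ℝ} (hρ : 0 < ρ) (hr : ρ < r) (hq : 0 < q) {W Z : ℝ≥0∞}
    {B : ℕ → ℝ≥0∞} {w c : ℝ≥0∞} (hw : w = 2⁻¹ ^ ((r - ρ) / 2))
    (hZ : W ^ q + ∑' m : ℕ, (w ^ m) ^ (q / ρ) * B m ^ q ≤ Z) :
    c * W ^ r + ∑' m : ℕ, ((2⁻¹ ^ m) * W) ^ (r - ρ) * (4 ^ ρ * B m ^ ρ)
      ≤ (c + 4 ^ ρ * ∑' m : ℕ, w ^ m) * (Z ^ (1 / q)) ^ r := by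
  have hWZ : W ≤ Z ^ (1 / q) := by
    rw [one_div, ENNReal.le_rpow_inv_iff hq]
    exact le_self_add.trans hZ
  have hB : ∀ m, w ^ m * B m ^ ρ ≤ (Z ^ (1 / q)) ^ ρ := by
    intro m
    have h1 : (w ^ m * B m ^ ρ) ^ (q / ρ) ≤ Z := by
      rw [ENNReal.mul_rpow_of_nonneg _ _ (by positivity), ← ENNReal.rpow_mul,
        mul_div_cancel₀ _ hρ.ne']
      exact (ENNReal.le_tsum (f := fun m : ℕ => (w ^ m) ^ (q / ρ) * B m ^ q) m).trans
        (le_add_self.trans hZ)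
    rw [← ENNReal.rpow_mul, one_div_mul_eq_div, ← inv_div, ENNReal.le_rpow_inv_iff (by positivity)]
    exact h1
  rw [add_mul]
  refine add_le_add ?_ ?_
  · gcongr
    linarith
  · rw [mul_assoc, ← ENNReal.tsum_mul_right, ← ENNReal.tsum_mul_left]
    refine ENNReal.tsum_le_tsum fun m => ?_
    have hε : 0 < r - ρ := by linarith
    have h2 : ((2⁻¹ : ℝ≥0∞) ^ m) ^ (r - ρ) = w ^ m * w ^ m := by
      rw [hw, ← mul_pow, ← ENNReal.rpow_add_of_nonneg _ _ (by positivity) (by positivity),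
        add_halves, ← ENNReal.rpow_natCast, ← ENNReal.rpow_natCast, ← ENNReal.rpow_mul,
        ← ENNReal.rpow_mul, mul_comm]
    rw [ENNReal.mul_rpow_of_nonneg _ _ hε.le, h2]
    calc w ^ m * w ^ m * W ^ (r - ρ) * (4 ^ ρ * B m ^ ρ)
        = 4 ^ ρ * (w ^ m * (W ^ (r - ρ) * (w ^ m * B m ^ ρ))) := by ring
      _ ≤ 4 ^ ρ * (w ^ m * ((Z ^ (1 / q)) ^ (r - ρ) * (Z ^ (1 / q)) ^ ρ)) := by
          gcongr
          exact hB m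
      _ = 4 ^ ρ * (w ^ m * (Z ^ (1 / q)) ^ r) := by
          rw [← ENNReal.rpow_add_of_nonneg _ _ hε.le hρ.le, sub_add_cancel]

lemma tsum_pow_lt_top {x : ℝ≥0∞} (hx : x < 1) : ∑' m : ℕ, x ^ m < ∞ := by
  rw [ENNReal.tsum_geometric, ENNReal.inv_lt_top]
  exact tsub_pos_of_lt hx

lemma pow_rpow_comm (x : ℝ≥0∞) (n : ℕ) (y : ℝ) : (x ^ n) ^ y = (x ^ y) ^ n := by
  rw [← ENNReal.rpow_natCast, ← ENNReal.rpow_natCast, ← ENNReal.rpow_mul, ← ENNReal.rpow_mul,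
    mul_comm]

/-- The variation norm estimate, deduced from the maximal estimate at the endpoint exponent `ρ` for
the threshold partitions and for the trivial partition. -/
theorem exists_eLpNorm_rVar₂_le {q q₀ q₁ r r₁ : ℝ≥0∞} (hq0 : 0 < q) (hq₁ : 0 < q₁) (hq₀ : 1 ≤ q₀)
    (hq₀' : q₀ < ∞) (hr0 : 0 < r) (hr₁ : 1 ≤ r₁) (hq : 1 / q = 1 / q₀ + 1 / q₁)
    (hr : 1 / r < 1 / 2 + 1 / r₁) :
    ∃ C : ℝ≥0, ∀ {Ω : Type*} {m : MeasurableSpace Ω} {μ : Measure Ω} [IsProbabilityMeasure μ]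
      {ℱ : Filtration ℕ m} {f g : ℕ → Ω → ℂ}, Adapted ℱ f → Martingale g ℱ μ →
      eLpNorm (fun ω => rVar₂ r (paraproduct (delta fun n => f n ω) fun n => g n ω)) q μ
        ≤ C * eLpNorm (fun ω => rVar r₁ fun n => f n ω) q₁ μ
          * eLpNorm (fun ω => squareFn fun n => g n ω) q₀ μ := by
  have hr₁0 : r₁ ≠ 0 := (zero_lt_one.trans_le hr₁).ne'
  have hqt : q ≠ ∞ := by
    rintro rfl
    simp only [one_div, ENNReal.inv_top] at hq
    exact hq₀'.ne (ENNReal.inv_eq_zero.1 (add_eq_zero.1 hq.symm).1)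
  set ρ : ℝ≥0∞ := (1 / 2 + 1 / r₁)⁻¹ with hρ_def
  have hρ : 1 / ρ = 1 / 2 + 1 / r₁ := by rw [hρ_def, one_div, inv_inv]
  have hρ0 : ρ ≠ 0 := by
    rw [hρ_def, ENNReal.inv_ne_zero, ENNReal.add_ne_top]
    exact ⟨by simp, by simpa using hr₁0⟩
  have hρt : ρ ≠ ∞ := by
    rw [hρ_def, ENNReal.inv_ne_top]
    simp
  have hρr : ρ < r := by
    rw [← hρ, one_div, one_div, ENNReal.inv_lt_inv] at hr
    exact hr
  obtain ⟨C, hC⟩ := exists_eLpNorm_paraproductMax_le hq₁ hq₀ hq₀' hr₁ hq hρ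
  have hpart : ∀ {Ω : Type _} {m : MeasurableSpace Ω} {μ : Measure Ω} [IsProbabilityMeasure μ]
      {ℱ : Filtration ℕ m} {f g : ℕ → Ω → ℂ} {τ : ℕ → Ω → WithTop ℕ},
      Adapted ℱ f → Martingale g ℱ μ → IsAdaptedPartition ℱ τ →
      eLpNorm (fun ω => ellNorm ρ fun k => paraproductMax f g τ k ω) q μ
        ≤ C * eLpNorm (fun ω => rVar r₁ fun n => f n ω) q₁ μ
          * eLpNorm (fun ω => squareFn fun n => g n ω) q₀ μ := by
    intro Ω m μ _ ℱ f g τ hf hg hτ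
    refine (hC hf hg hτ).trans ?_
    gcongr
    refine eLpNorm_mono_enorm fun ω => ?_
    simpa using ellNorm_deviation_le_rVar hr₁0 f (hτ.mono ω)
  rcases eq_or_ne r ∞ with rfl | hrt
  · refine ⟨C, fun {Ω m μ} _ {ℱ f g} hf hg => le_trans (eLpNorm_mono_enorm fun ω => ?_)
      (hpart hf hg isAdaptedPartition_trivialPartition)⟩
    simp only [enorm_eq_self, rVar₂, if_true]
    exact iSup_le fun s => iSup₂_le fun t _ =>
      (enorm_paraproduct_le_trivialPartition f g ω s t).trans
        (le_ellNorm hρ0 (fun k => paraproductMax f g (trivialPartition Ω) k ω) 0)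
  have hρ' := ENNReal.toReal_pos hρ0 hρt
  have hr' := ENNReal.toReal_pos hr0.ne' hrt
  have hq' := ENNReal.toReal_pos hq0.ne' hqt
  have hρr' : ρ.toReal < r.toReal := (ENNReal.toReal_lt_toReal hρt hrt).2 hρr
  -- half of the decay `2 ^ (-m * (r - ρ))` pays for exchanging the sum over `m` with the `L^q` norm
  set w : ℝ≥0∞ := 2⁻¹ ^ ((r.toReal - ρ.toReal) / 2) with hw
  have hw1 : w < 1 := ENNReal.rpow_lt_one (by norm_num) (by linarith)
  set κ := q.toReal / ρ.toReal with hκ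
  have hκ0 : 0 < κ := by positivity
  have hwκ : w ^ κ < 1 := ENNReal.rpow_lt_one hw1 hκ0
  set c : ℝ≥0∞ := ENNReal.ofReal (1 - 2 ^ (-r.toReal))⁻¹ + 4 ^ ρ.toReal * ∑' m : ℕ, w ^ m with hc
  have hct : c ≠ ∞ := ENNReal.add_ne_top.2 ⟨ENNReal.ofReal_ne_top, ENNReal.mul_ne_top
    (ENNReal.rpow_ne_top_of_nonneg hρ'.le (by norm_num)) (tsum_pow_lt_top hw1).ne⟩
  set d : ℝ≥0∞ := 1 + ∑' m : ℕ, (w ^ κ) ^ m with hd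
  have hdt : d ≠ ∞ := ENNReal.add_ne_top.2 ⟨ENNReal.one_ne_top, (tsum_pow_lt_top hwκ).ne⟩
  have hDt : c ^ (1 / r.toReal) * d ^ (1 / q.toReal) ≠ ∞ := ENNReal.mul_ne_top
    (ENNReal.rpow_ne_top_of_nonneg (by positivity) hct)
    (ENNReal.rpow_ne_top_of_nonneg (by positivity) hdt)
  refine ⟨(c ^ (1 / r.toReal) * d ^ (1 / q.toReal)).toNNReal * C,
    fun {Ω m μ} _ {ℱ f g} hf hg => ?_⟩
  rw [ENNReal.coe_mul, ENNReal.coe_toNNReal hDt]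
  have hga : Adapted ℱ g := hg.1.adapted
  set K : ℝ≥0∞ := C * eLpNorm (fun ω => rVar r₁ fun n => f n ω) q₁ μ
    * eLpNorm (fun ω => squareFn fun n => g n ω) q₀ μ with hK
  let P : Ω → ℕ → ℕ → ℂ := fun ω => paraproduct (delta fun n => f n ω) fun n => g n ω
  let τ : ℕ → ℕ → Ω → WithTop ℕ := fun m k ω => thresholdTime (2⁻¹ ^ (m + 1)) (P ω) k
  have hτ : ∀ m, IsAdaptedPartition ℱ (τ m) := fun m =>
    isAdaptedPartition_thresholdTime (fun s t n htn => measurable_paraproduct hf hga htn) _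
  let B : ℕ → Ω → ℝ≥0∞ := fun m ω => ellNorm ρ fun k => paraproductMax f g (τ m) k ω
  let W : Ω → ℝ≥0∞ := fun ω => ellNorm ρ fun k => paraproductMax f g (trivialPartition Ω) k ω
  have hBm : ∀ m, Measurable (B m) := fun m =>
    measurable_ellNorm ρ (measurable_paraproductMax (hτ m) hf hga)
  have hWm : Measurable W := measurable_ellNorm ρ
    (measurable_paraproductMax (isAdaptedPartition_trivialPartition (ℱ := ℱ)) hf hga)
  have hpow : ∀ h : Ω → ℝ≥0∞, eLpNorm h q μ ≤ K → ∫⁻ ω, h ω ^ q.toReal ∂μ ≤ K ^ q.toReal := by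
    intro h hle
    rw [eLpNorm_eq_lintegral_rpow_enorm_toReal hq0.ne' hqt, one_div,
      ENNReal.rpow_inv_le_iff hq'] at hle
    simpa using hle
  have hBK : ∀ m, ∫⁻ ω, B m ω ^ q.toReal ∂μ ≤ K ^ q.toReal := fun m =>
    hpow _ (hpart hf hg (hτ m))
  have hWK : ∫⁻ ω, W ω ^ q.toReal ∂μ ≤ K ^ q.toReal :=
    hpow _ (hpart hf hg isAdaptedPartition_trivialPartition)
  let Z : Ω → ℝ≥0∞ := fun ω => W ω ^ q.toReal + ∑' m : ℕ, (w ^ m) ^ κ * B m ω ^ q.toReal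
  have hZ : ∫⁻ ω, Z ω ∂μ ≤ d * K ^ q.toReal := by
    have h1 : ∀ m : ℕ, Measurable fun ω => (w ^ m) ^ κ * B m ω ^ q.toReal := fun m =>
      ((hBm m).pow_const _).const_mul _
    rw [lintegral_add_left (hWm.pow_const _), lintegral_tsum fun m => (h1 m).aemeasurable, hd,
      add_mul, one_mul]
    refine add_le_add hWK ?_
    rw [← ENNReal.tsum_mul_right]
    refine ENNReal.tsum_le_tsum fun m => ?_
    rw [lintegral_const_mul _ ((hBm m).pow_const _)]
    rw [pow_rpow_comm]
    gcongr
    exact hBK m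
  have hpath : ∀ ω, rVar₂ r (P ω) ≤ c ^ (1 / r.toReal) * Z ω ^ (1 / q.toReal) := by
    intro ω
    rw [rVar₂, if_neg hrt]
    refine iSup_le fun J => iSup₂_le fun u hu => ?_
    have e : c ^ (1 / r.toReal) * Z ω ^ (1 / q.toReal)
        = (c * (Z ω ^ (1 / q.toReal)) ^ r.toReal) ^ (1 / r.toReal) := by
      rw [ENNReal.mul_rpow_of_nonneg _ _ (by positivity), ← ENNReal.rpow_mul _ r.toReal,
        mul_one_div_cancel hr'.ne', ENNReal.rpow_one]
    rw [e]
    refine ENNReal.rpow_le_rpow ?_ (by positivity)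
    have h1 := sum_rpow_le_threshold (P := P ω) (fun s t hts => paraproduct_of_le _ _ hts) hρ' hρr'
      (W := W ω) (fun s t => (enorm_paraproduct_le_trivialPartition f g ω s t).trans
        (le_ellNorm hρ0 (fun k => paraproductMax f g (trivialPartition Ω) k ω) 0)) hu
    have h2 : ∀ m : ℕ, ∑' k, blockMax (P ω) (thresholdTime (2⁻¹ ^ (m + 1)) (P ω)) k ^ ρ.toReal
        = B m ω ^ ρ.toReal := fun m => by
      simp only [B]
      rw [ellNorm, if_neg hρt, one_div, ENNReal.rpow_inv_rpow hρ'.ne']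
      rfl
    simp only [h2] at h1
    exact h1.trans (threshold_sum_le hρ' hρr' hq' hw le_rfl)
  rw [eLpNorm_eq_lintegral_rpow_enorm_toReal hq0.ne' hqt]
  simp only [enorm_eq_self]
  calc (∫⁻ ω, rVar₂ r (P ω) ^ q.toReal ∂μ) ^ (1 / q.toReal)
      ≤ (∫⁻ ω, (c ^ (1 / r.toReal)) ^ q.toReal * Z ω ∂μ) ^ (1 / q.toReal) := by
        gcongr with ω
        refine (ENNReal.rpow_le_rpow (hpath ω) hq'.le).trans (le_of_eq ?_)
        rw [ENNReal.mul_rpow_of_nonneg _ _ hq'.le, one_div q.toReal,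
          ENNReal.rpow_inv_rpow hq'.ne']
    _ = ((c ^ (1 / r.toReal)) ^ q.toReal * ∫⁻ ω, Z ω ∂μ) ^ (1 / q.toReal) := by
        rw [lintegral_const_mul' _ _ (ENNReal.rpow_ne_top_of_nonneg hq'.le
          (ENNReal.rpow_ne_top_of_nonneg (by positivity) hct))]
    _ ≤ ((c ^ (1 / r.toReal)) ^ q.toReal * (d * K ^ q.toReal)) ^ (1 / q.toReal) := by gcongr
    _ = c ^ (1 / r.toReal) * d ^ (1 / q.toReal) * K := by
        rw [ENNReal.mul_rpow_of_nonneg _ _ (by positivity),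
          ENNReal.mul_rpow_of_nonneg _ _ (by positivity), one_div q.toReal,
          ENNReal.rpow_rpow_inv hq'.ne', ENNReal.rpow_rpow_inv hq'.ne', mul_assoc]
    _ = _ := by rw [hK]; ring

end Variation

end MartingaleParaproduct

theorem mainTheorem9 :
    -- the maximal estimate over adapted partitions
    (∀ q q₀ q₁ r r₁ : ℝ≥0∞, 0 < q → 0 < q₁ → 1 ≤ q₀ → q₀ < ∞ → 1 ≤ r → r < ∞ → 1 ≤ r₁ →
      1 / q = 1 / q₀ + 1 / q₁ → 1 / r = 1 / 2 + 1 / r₁ →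
      ∃ C : ℝ≥0, ∀ (Ω : Type*) (m : MeasurableSpace Ω) (μ : Measure Ω) [IsProbabilityMeasure μ]
        (ℱ : Filtration ℕ m) (f g : ℕ → Ω → ℂ) (τ : ℕ → Ω → WithTop ℕ),
        Adapted ℱ f → Martingale g ℱ μ → IsAdaptedPartition ℱ τ →
        eLpNorm (fun ω => ellNorm r fun k =>
            ⨆ (s : ℕ) (t : ℕ) (_ : τ k ω ≤ s ∧ s ≤ t ∧ t ≤ τ (k + 1) ω),
              ‖paraproduct (delta fun n => f n ω) (fun n => g n ω) s t‖ₑ) q μ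
          ≤ C * eLpNorm (fun ω => ellNorm r₁ fun k =>
                ⨆ (t : ℕ) (_ : τ k ω ≤ t ∧ t < τ (k + 1) ω),
                  ‖f t ω - stoppedValue f (τ k) ω‖ₑ) q₁ μ
              * eLpNorm (fun ω => squareFn fun n => g n ω) q₀ μ) ∧
    -- the variation norm estimate
    (∀ q q₀ q₁ r r₁ : ℝ≥0∞, 0 < q → 0 < q₁ → 1 ≤ q₀ → q₀ < ∞ → 0 < r → 1 ≤ r₁ →
      1 / q = 1 / q₀ + 1 / q₁ → 1 / r < 1 / 2 + 1 / r₁ →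
      ∃ C : ℝ≥0, ∀ (Ω : Type*) (m : MeasurableSpace Ω) (μ : Measure Ω) [IsProbabilityMeasure μ]
        (ℱ : Filtration ℕ m) (f g : ℕ → Ω → ℂ),
        Adapted ℱ f → Martingale g ℱ μ →
        eLpNorm (fun ω => rVar₂ r (paraproduct (delta fun n => f n ω) fun n => g n ω)) q μ
          ≤ C * eLpNorm (fun ω => rVar r₁ fun n => f n ω) q₁ μ
              * eLpNorm (fun ω => squareFn fun n => g n ω) q₀ μ) := by
  refine ⟨fun q q₀ q₁ r r₁ _ hq₁ hq₀ hq₀' _ _ hr₁ hq hr => ?_,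
    fun q q₀ q₁ r r₁ hq0 hq₁ hq₀ hq₀' hr0 hr₁ hq hr => ?_⟩
  · obtain ⟨C, hC⟩ := exists_eLpNorm_paraproductMax_le hq₁ hq₀ hq₀' hr₁ hq hr
    exact ⟨C, fun Ω m μ _ ℱ f g τ hf hg hτ => hC hf hg hτ⟩
  · obtain ⟨C, hC⟩ := exists_eLpNorm_rVar₂_le hq0 hq₁ hq₀ hq₀' hr0 hr₁ hq hr
    exact ⟨C, fun Ω m μ _ ℱ f g hf hg => hC hf hg⟩
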